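/- Let $\mathbb{D}=\{z\in\mathbb{C}:|z|<1\}$ carry the normalized area measure $d\nu(z)=\frac1\pi\,dz$, let $A^2(\mathbb{D})\subset L^2(\mathbb{D},\nu)$ be the Bergman space of square-integrable holomorphic functions, and let $P$ be the orthogonal projection of $L^2(\mathbb{D},\nu)$ onto $A^2(\mathbb{D})$. For real-valued $\sigma\in L^\infty(\mathbb{D},\nu)$ let $T_\sigma f=P(\sigma f)$ be the Toeplitz operator on $A^2(\mathbb{D})$. For $N\ge 0$ let $\mathcal{K}_N$ be the span of the orthonormal functions $\sqrt{n+1}\,z^n$, $0\le n\le N$ (that is, $z^n/\sqrt{c_{2n+1}}$ with $c_{2n+1}=\frac1{n+1}$), let $P_N$ be the orthogonal projection onto $\mathcal{K}_N$, and regard $P_NT_\sigma P_N$ as a self-adjoint operator on the $(N+1)$-dimensional space $\mathcal{K}_N$, with eigenvalues $\lambda_0^N(\sigma),\dots,\lambda_N^N(\sigma)$ counted with multiplicity. Write $\inf\sigma$ and $\sup\sigma$ for the essential infimum and supremum. Suppose that $\sigma$ has a radial limit, i.e. $\tilde\sigma(\theta)=\lim_{r\to1^-}\sigma(re^{i\theta})$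 exists for almost every $\theta\in(0,2\pi]$. (a) For every continuous $\psi:[\inf\sigma,\sup\sigma]\to\mathbb{C}$ the function $\psi\circ\tilde\sigma$ is integrable on $[0,2\pi]$ and $$\lim_{N\to\infty}\frac{1}{N+1}\operatorname{tr}\,\psi\left(P_NT_\sigma P_N\right)=\frac{1}{2\pi}\int_0^{2\pi}\psi(\tilde\sigma(\theta))\,d\theta .$$ (b) Let $\alpha,\beta\in(\inf\sigma,\sup\sigma)$ with $\alpha<\beta$ and either $\alpha>0$ or $\beta<0$, and suppose that $|\{\theta\in(0,2\pi]:\tilde\sigma(\theta)=\alpha\}|=|\{\theta\in(0,2\pi]:\tilde\sigma(\theta)=\beta\}|=0$. Then $$\lim_{N\to\infty}\frac{\#\{0\le j\le N:\alpha\le\lambda_j^N(\sigma)\le\beta\}}{N+1}=\frac{|\{\theta\in(0,2\pi]:\alpha\le\tilde\sigma(\theta)\le\beta\}|}{2\pi}.$$ -/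

import Mathlib

open MeasureTheory Filter Set
open scoped ENNReal Topology

namespace BergmanSzego

noncomputable section

/-- Normalized area measure `(1/π) dz` on the open unit disc, as a measure on `ℂ`. -/
def diskMeasure : Measure ℂ :=
  ENNReal.ofReal (Real.pi⁻¹) • (volume.restrict (Metric.ball (0 : ℂ) 1))

instance : IsProbabilityMeasure diskMeasure := by
  constructor
  have h : ENNReal.ofReal (Real.pi⁻¹) * (NNReal.pi : ℝ≥0∞) = 1 := by
    rw [ENNReal.ofReal_inv_of_pos Real.pi_pos]
    have h2 : (NNReal.pi : ℝ≥0∞) = ENNReal.ofReal Real.pi := by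
      rw [← NNReal.coe_real_pi, ENNReal.ofReal_coe_nnreal]
    rw [h2]
    exact ENNReal.inv_mul_cancel (by simp [Real.pi_pos]) (by simp)
  simp [diskMeasure, Complex.volume_ball, h]

theorem ae_diskMeasure_iff {p : ℂ → Prop} :
    (∀ᵐ z ∂diskMeasure, p z) ↔ ∀ᵐ z ∂(volume.restrict (Metric.ball (0 : ℂ) 1)), p z := by
  unfold diskMeasure
  rw [Measure.ae_ennreal_smul_measure_iff]
  simp [Real.pi_pos]

theorem ae_mem_disk : ∀ᵐ z ∂diskMeasure, z ∈ Metric.ball (0 : ℂ) 1 :=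
  ae_diskMeasure_iff.2 (ae_restrict_mem measurableSet_ball)

/-- The Bergman space `A²(𝔻)`: the (classes of) functions in `L²(𝔻, dz/π)` that have a
representative holomorphic on the open unit disc. -/
def bergmanSpace : Submodule ℂ (Lp ℂ 2 diskMeasure) where
  carrier := {f | ∃ g : ℂ → ℂ, DifferentiableOn ℂ g (Metric.ball 0 1) ∧ f =ᵐ[diskMeasure] g}
  zero_mem' := ⟨0, differentiableOn_const 0, Lp.coeFn_zero _ _ _⟩
  add_mem' := by
    rintro a b ⟨g, hg, hag⟩ ⟨h, hh, hbh⟩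
    exact ⟨g + h, hg.add hh, (Lp.coeFn_add a b).trans (hag.add hbh)⟩
  smul_mem' := by
    rintro c a ⟨g, hg, hag⟩
    exact ⟨c • g, hg.const_smul c, (Lp.coeFn_smul c a).trans (hag.const_smul c)⟩

theorem enorm_center_le_circle {g : ℂ → ℂ} {z : ℂ} {r : ℝ} (hr : 0 < r)
    (hg : DifferentiableOn ℂ g (Metric.closedBall z r)) :
    ENNReal.ofReal (2 * Real.pi) * ‖g z‖ₑ ≤
      ∫⁻ θ in Ioo (-Real.pi) Real.pi, ‖g (circleMap z r θ)‖ₑ := by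
  have h1 : Real.circleAverage g z r = g z := by
    apply DiffContOnCl.circleAverage
    rw [abs_of_pos hr]
    exact hg.diffContOnCl_ball subset_rfl
  rw [Real.circleAverage_def] at h1
  have h2 : (∫ θ in (0)..(2 * Real.pi), g (circleMap z r θ)) =
      ∫ θ in (-Real.pi)..Real.pi, g (circleMap z r θ) := by
    have hp : Function.Periodic (fun θ => g (circleMap z r θ)) (2 * Real.pi) := fun θ => by
      simp only [periodic_circleMap z r θ]
    have := hp.intervalIntegral_add_eq 0 (-Real.pi)
    simpa [show -Real.pi + 2 * Real.pi = Real.pi by ring] using this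
  have h3 : (∫ θ in Ioo (-Real.pi) Real.pi, g (circleMap z r θ)) = (2 * Real.pi) • g z := by
    rw [← h1, h2, smul_smul, mul_inv_cancel₀ (by positivity), one_smul,
      intervalIntegral.integral_of_le (by linarith [Real.pi_pos]), integral_Ioc_eq_integral_Ioo]
  calc ENNReal.ofReal (2 * Real.pi) * ‖g z‖ₑ = ‖(2 * Real.pi) • g z‖ₑ := by
        rw [enorm_smul, Real.enorm_of_nonneg (by positivity)]
    _ ≤ _ := by
        rw [← h3]
        exact enorm_integral_le_lintegral_enorm _

theorem enorm_center_le_ball {g : ℂ → ℂ} {z : ℂ} {R : ℝ} (hR : 0 < R)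
    (hg : DifferentiableOn ℂ g (Metric.ball z R)) :
    ENNReal.ofReal (Real.pi * R ^ 2) * ‖g z‖ₑ ≤ ∫⁻ w in Metric.ball z R, ‖g w‖ₑ := by
  set F : ℂ → ℝ≥0∞ := (Metric.ball (0 : ℂ) R).indicator (fun w => ‖g (z + w)‖ₑ) with hF
  have e1 : ∫⁻ w in Metric.ball z R, ‖g w‖ₑ = ∫⁻ w, F w := by
    rw [← lintegral_indicator measurableSet_ball,
      ← lintegral_add_left_eq_self _ z]
    refine lintegral_congr fun w => ?_
    simp [hF, indicator, Metric.mem_ball, dist_eq_norm]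
  have hFm : Measurable F := by
    have hc : ContinuousOn (fun w => ‖g (z + w)‖ₑ) (Metric.ball (0 : ℂ) R) := by
      refine ContinuousOn.enorm (hg.continuousOn.comp (by fun_prop) ?_)
      intro w hw
      simpa [Metric.mem_ball, dist_eq_norm] using hw
    classical
    rw [hF, ← piecewise_eq_indicator]
    exact hc.measurable_piecewise continuousOn_const measurableSet_ball
  rw [e1, ← Complex.lintegral_comp_polarCoord_symm]
  have htar : polarCoord.target = Ioi (0 : ℝ) ×ˢ Ioo (-Real.pi) Real.pi := rfl
  have hmeas : Measurable fun p : ℝ × ℝ =>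
      ENNReal.ofReal p.1 • F (Complex.polarCoord.symm p) := by
    have h1 : Measurable fun p : ℝ × ℝ => Complex.polarCoord.symm p := by
      simp only [Complex.polarCoord_symm_apply]
      fun_prop
    have h2 : Measurable fun p : ℝ × ℝ => ENNReal.ofReal p.1 := by fun_prop
    exact h2.mul (hFm.comp h1)
  rw [htar, Measure.volume_eq_prod, ← Measure.prod_restrict,
    lintegral_prod _ hmeas.aemeasurable]
  calc ENNReal.ofReal (Real.pi * R ^ 2) * ‖g z‖ₑ
      = ∫⁻ r in Ioo 0 R, ENNReal.ofReal (r * (2 * Real.pi)) * ‖g z‖ₑ := by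
        rw [lintegral_mul_const _ (by fun_prop), ← ofReal_integral_eq_lintegral_ofReal]
        · congr 2
          rw [← integral_Ioc_eq_integral_Ioo, ← intervalIntegral.integral_of_le hR.le,
            intervalIntegral.integral_mul_const, integral_id]
          ring
        · exact (Continuous.integrableOn_Icc (by fun_prop)).mono_set Ioo_subset_Icc_self
        · filter_upwards [ae_restrict_mem measurableSet_Ioo] with r hr
          have := hr.1
          have := Real.pi_pos
          simp only [Pi.zero_apply]
          positivity
    _ ≤ ∫⁻ r in Ioo 0 R, ∫⁻ θ in Ioo (-Real.pi) Real.pi,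
          ENNReal.ofReal r • F (Complex.polarCoord.symm (r, θ)) := by
        refine setLIntegral_mono' measurableSet_Ioo fun r hr => ?_
        have h := enorm_center_le_circle hr.1
          (hg.mono (Metric.closedBall_subset_ball hr.2))
        rw [ENNReal.ofReal_mul hr.1.le, mul_assoc]
        simp only [smul_eq_mul]
        rw [lintegral_const_mul' _ _ ENNReal.ofReal_ne_top]
        gcongr
        refine h.trans (le_of_eq (lintegral_congr fun θ => ?_))
        have hm : Complex.polarCoord.symm (r, θ) ∈ Metric.ball (0 : ℂ) R := by
          simp [Metric.mem_ball, abs_of_pos hr.1, hr.2]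
        rw [hF, indicator_of_mem hm]
        congr 2
        simp [circleMap, Complex.polarCoord_symm_apply, Complex.exp_mul_I]
    _ ≤ _ := lintegral_mono_set Ioo_subset_Ioi_self

/-- Point evaluations are bounded on holomorphic functions in `L²(𝔻)`. -/
theorem enorm_le_eLpNorm {g : ℂ → ℂ} (hg : DifferentiableOn ℂ g (Metric.ball 0 1)) {z : ℂ}
    {R : ℝ} (hR : 0 < R) (hz : ‖z‖ + R ≤ 1) :
    ENNReal.ofReal (R ^ 2) * ‖g z‖ₑ ≤ eLpNorm g 2 diskMeasure := by
  have hsub : Metric.ball z R ⊆ Metric.ball 0 1 :=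
    Metric.ball_subset_ball' (by rw [dist_zero_right]; linarith)
  have hm : AEStronglyMeasurable g diskMeasure :=
    (hg.continuousOn.aestronglyMeasurable measurableSet_ball).smul_measure _
  refine le_trans ?_ (eLpNorm_le_eLpNorm_of_exponent_le (p := 1) (by norm_num) hm)
  rw [eLpNorm_one_eq_lintegral_enorm, diskMeasure, lintegral_smul_measure, smul_eq_mul]
  have h := (enorm_center_le_ball hR (hg.mono hsub)).trans (lintegral_mono_set hsub)
  calc ENNReal.ofReal (R ^ 2) * ‖g z‖ₑ
      = ENNReal.ofReal (Real.pi⁻¹) * (ENNReal.ofReal (Real.pi * R ^ 2) * ‖g z‖ₑ) := by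
        rw [← mul_assoc, ← ENNReal.ofReal_mul (by positivity), ← mul_assoc,
          inv_mul_cancel₀ Real.pi_ne_zero, one_mul]
    _ ≤ _ := by gcongr

theorem isClosed_bergmanSpace : IsClosed (bergmanSpace : Set (Lp ℂ 2 diskMeasure)) := by
  refine IsSeqClosed.isClosed fun f F hf hlim => ?_
  choose g hg hfg using hf
  have hC : CauchySeq f := hlim.cauchySeq
  have hUC : ∀ ρ : ℝ, ρ < 1 → UniformCauchySeqOn g atTop (Metric.closedBall 0 ρ) := by
    intro ρ hρ
    rw [Metric.uniformCauchySeqOn_iff]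
    intro ε hε
    have hR : 0 < 1 - ρ := by linarith
    obtain ⟨N, hN⟩ := Metric.cauchySeq_iff.1 hC ((1 - ρ) ^ 2 * ε) (by positivity)
    refine ⟨N, fun m hm n hn z hz => ?_⟩
    have h1 := enorm_le_eLpNorm ((hg m).sub (hg n)) hR
      (z := z) (by rw [mem_closedBall_zero_iff] at hz; linarith)
    have h2 : eLpNorm (g m - g n) 2 diskMeasure = edist (f m) (f n) := by
      rw [Lp.edist_def]
      exact eLpNorm_congr_ae ((hfg m).symm.sub (hfg n).symm)
    have h3 := hN m hm n hn
    rw [h2, edist_dist, ← ofReal_norm, ← ENNReal.ofReal_mul (by positivity),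
      ENNReal.ofReal_le_ofReal_iff dist_nonneg] at h1
    rw [dist_eq_norm]
    exact lt_of_mul_lt_mul_left (h1.trans_lt h3) (by positivity)
  have hex : ∀ z ∈ Metric.ball (0 : ℂ) 1, ∃ w, Tendsto (fun n => g n z) atTop (𝓝 w) := by
    intro z hz
    have := (hUC ‖z‖ (by simpa using hz)).cauchySeq (x := z) (by simp)
    exact cauchySeq_tendsto_of_complete this
  choose! G hG using hex
  have hloc : TendstoLocallyUniformlyOn g G atTop (Metric.ball 0 1) := by
    rw [tendstoLocallyUniformlyOn_iff_forall_isCompact Metric.isOpen_ball]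
    intro K hK hKc
    obtain ⟨ρ, hρ, hKρ⟩ : ∃ ρ : ℝ, ρ < 1 ∧ K ⊆ Metric.closedBall 0 ρ := by
      rcases K.eq_empty_or_nonempty with rfl | hne
      · exact ⟨0, one_pos, empty_subset _⟩
      · obtain ⟨x, hx, hmax⟩ := hKc.exists_isMaxOn hne continuous_norm.continuousOn
        exact ⟨‖x‖, by simpa using hK hx, fun y hy => by simpa using hmax hy⟩
    exact ((hUC ρ hρ).mono hKρ).tendstoUniformlyOn_of_tendsto fun x hx => hG x (hK hx)
  refine ⟨G, hloc.differentiableOn (Eventually.of_forall hg) Metric.isOpen_ball, ?_⟩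
  obtain ⟨ns, hns, hae⟩ := (tendstoInMeasure_of_tendsto_Lp hlim).exists_seq_tendsto_ae
  have hall : ∀ᵐ z ∂diskMeasure, ∀ n, f n z = g n z := ae_all_iff.2 hfg
  filter_upwards [hae, hall, ae_mem_disk] with z h1 h2 h3
  refine tendsto_nhds_unique h1 ?_
  simp only [h2]
  exact (hG z h3).comp hns.tendsto_atTop

instance : CompleteSpace bergmanSpace :=
  isClosed_bergmanSpace.completeSpace_coe

/-- The operator `M_s` of multiplication by a bounded function on `L²(𝔻)`. -/
def mulOp (s : Lp ℂ ∞ diskMeasure) : Lp ℂ 2 diskMeasure →L[ℂ] Lp ℂ 2 diskMeasure :=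
  (ContinuousLinearMap.mul ℂ ℂ).holderL diskMeasure ∞ 2 2 s

/-- The Toeplitz operator `T_s = P M_s : A²(𝔻) → A²(𝔻)`, where `P` is the orthogonal projection
of `L²(𝔻)` onto `A²(𝔻)`. -/
def toeplitz (s : Lp ℂ ∞ diskMeasure) : bergmanSpace →L[ℂ] bergmanSpace :=
  bergmanSpace.orthogonalProjectionOnto ∘L mulOp s ∘L bergmanSpace.subtypeL

theorem memLp_monomial (n : ℕ) :
    MemLp (fun z : ℂ => (Real.sqrt (n + 1) : ℂ) * z ^ n) 2 diskMeasure := by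
  refine MemLp.of_bound (Continuous.aestronglyMeasurable (by fun_prop)) (Real.sqrt (n + 1)) ?_
  filter_upwards [ae_mem_disk] with z hz
  have hz1 : ‖z‖ ≤ 1 := by
    rw [mem_ball_zero_iff] at hz
    exact hz.le
  rw [norm_mul, norm_pow, Complex.norm_real, Real.norm_of_nonneg (Real.sqrt_nonneg _)]
  exact mul_le_of_le_one_right (Real.sqrt_nonneg _) (pow_le_one₀ (norm_nonneg _) hz1)

/-- The normalized monomial `√(n+1) zⁿ` as an element of `A²(𝔻)`. -/
def monomial (n : ℕ) : bergmanSpace :=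
  ⟨(memLp_monomial n).toLp, fun z : ℂ => (Real.sqrt (n + 1) : ℂ) * z ^ n,
    by fun_prop, MemLp.coeFn_toLp _⟩

/-- `K_N`, the span of the normalized monomials of degree `0, 1, …, N`. It is a subspace of `A²(𝔻)`
and is regarded as a subspace of `L²(𝔻)`. -/
def monomialSpan (N : ℕ) : Submodule ℂ (Lp ℂ 2 diskMeasure) :=
  Submodule.span ℂ ((fun n => (monomial n : Lp ℂ 2 diskMeasure)) '' Set.Iic N)

theorem monomialSpan_le (N : ℕ) : monomialSpan N ≤ bergmanSpace := by
  refine Submodule.span_le.2 ?_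
  rintro _ ⟨n, -, rfl⟩
  exact (monomial n).2

instance (N : ℕ) : FiniteDimensional ℂ (monomialSpan N) :=
  FiniteDimensional.span_of_finite ℂ ((Set.finite_Iic N).image _)

instance (N : ℕ) : CompleteSpace (monomialSpan N) :=
  FiniteDimensional.complete ℂ _

/-- The compression `P_N T_s P_N`, as an operator on the range `K_N` of the orthogonal projection
`P_N`: an element of `K_N ⊆ A²(𝔻)` is mapped by `T_s` to `A²(𝔻)` and then projected to `K_N`. -/
def compression (s : Lp ℂ ∞ diskMeasure) (N : ℕ) : monomialSpan N →L[ℂ] monomialSpan N :=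
  (monomialSpan N).orthogonalProjectionOnto ∘L bergmanSpace.subtypeL ∘L toeplitz s ∘L
    (monomialSpan N).subtypeL.codRestrict bergmanSpace (fun x => monomialSpan_le N x.2)

/-- `tr ψ(A)` for an operator `A` on a finite-dimensional Hilbert space, with `ψ(A)` given by the
continuous functional calculus. The function `ψ` is defined on the real line; it is used for
self-adjoint `A`, whose spectrum is real. -/
def traceFun {V : Type*} [NormedAddCommGroup V] [InnerProductSpace ℂ V] [CompleteSpace V]
    (ψ : ℝ → ℂ) (A : V →L[ℂ] V) : ℂ :=
  LinearMap.trace ℂ V (cfc (fun z : ℂ => ψ z.re) A).toLinearMap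

open scoped Classical in
/-- The number of real eigenvalues of `A` in the set `S`, counted with algebraic multiplicity
(the same as the geometric one for self-adjoint `A`). -/
def eigenvalueCount {V : Type*} [NormedAddCommGroup V] [InnerProductSpace ℂ V]
    [FiniteDimensional ℂ V] (A : V →L[ℂ] V) (S : Set ℝ) : ℕ :=
  A.toLinearMap.charpoly.roots.countP (fun z => z ∈ Complex.ofReal '' S)

/-- `σt` is the radial limit of `σ`: for almost every `θ`, `σ(r e^{iθ}) → σt(θ)` as `r → 1⁻`. -/
def HasRadialLimit (σ : ℂ → ℝ) (σt : ℝ → ℝ) : Prop :=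
  ∀ᵐ θ ∂(volume.restrict (Set.Ioc 0 (2 * Real.pi))),
    Tendsto (fun r : ℝ => σ (circleMap 0 r θ)) (𝓝[<] 1) (𝓝 (σt θ))

end

end BergmanSzego

/-!
The argument replaces the functional calculus by a variance estimate. Let `u_j` be orthonormal
eigenvectors of the compression `A_N` of `T_σ` to `K_N`, with eigenvalues `λ_j`. Since `K_N` lies in
the Bergman space, `⟨v, A_N u⟩ = ∫ σ v̄ u dν` (`inner_compression`), so `λ_j` is the mean of `σ` with
respect to the probability measure `|u_j|² dν`. Writing `Var_j` for the variance of `σ` under this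
measure, uniform continuity gives `|ψ(λ_j) - ∫ ψ(σ) |u_j|² dν| ≤ ε + C_ε Var_j` for every continuous
`ψ` (`norm_sub_integral_le_variance`). Summing over `j`, the sum of `ψ(λ_j)` agrees with the trace
of the compression of `T_{ψ∘σ}` up to `(N+1) ε + C_ε V_N`, where `V_N` is the sum of the `Var_j`
(`norm_sum_sub_trace_le`). Two facts finish the proof of (a).

* The trace of the compression of `T_f` is the sum of `(n+1) ∫ f |z|^{2n} dν` over `n ≤ N`. In polar
  coordinates the weights `(n+1) |z|^{2n}` concentrate on the unit circle, so each term, and hence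
  the Cesàro mean, tends to the mean of the radial limit of `f` (`tendsto_trace_compression`).
  Inserting powers of `z` and `z̄` shows in the same way that the matrix of `T_f` in the monomial
  basis converges along each diagonal to a Fourier coefficient of the radial limit
  (`tendsto_toeplitzCoeff`).
* `V_N = o(N)` (`eventually_totalVariance_lt`). Indeed `V_N` is the trace of the compression of
  `T_{σ²}` minus the squared Hilbert–Schmidt norm of `A_N`. After division by `N+1` the former tends
  to the mean of `σ̃²`, while the latter is asymptotically at least the sum of `|c_k|²` over any
  finite set of Fourier coefficients of `σ̃`; by Parseval these sums exhaust the mean of `σ̃²`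
  (`eventually_lt_sum_sq_toeplitzCoeff`).

Part (b) is the portmanteau theorem for the weak convergence of the eigenvalue distributions to
the distribution of `σ̃` that (a) expresses (`tendsto_eigenvalueDistribution`).
-/

namespace BergmanSzego

noncomputable section

/-! ### Polar coordinates on the disc -/

/-- Normalized arc length `dθ / 2π` on `(0, 2π]`. -/
def angleMeasure : Measure ℝ :=
  ENNReal.ofReal (2 * Real.pi)⁻¹ • volume.restrict (Ioc 0 (2 * Real.pi))

/-- The radial part `2 r dr` on `(0, 1)` of the normalized area measure. -/
def radialMeasure : Measure ℝ :=
  (volume.restrict (Ioo 0 1)).withDensity fun r => ENNReal.ofReal (2 * r)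

instance : IsProbabilityMeasure angleMeasure := by
  constructor
  have hpi := Real.pi_pos
  simp only [angleMeasure, Measure.smul_apply, Measure.restrict_apply_univ, Real.volume_Ioc,
    smul_eq_mul, sub_zero]
  rw [← ENNReal.ofReal_mul (by positivity), inv_mul_cancel₀ (by positivity), ENNReal.ofReal_one]

theorem ae_angleMeasure_iff {p : ℝ → Prop} :
    (∀ᵐ θ ∂angleMeasure, p θ) ↔ ∀ᵐ θ ∂(volume.restrict (Ioc 0 (2 * Real.pi))), p θ := by
  unfold angleMeasure
  rw [Measure.ae_ennreal_smul_measure_iff]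
  simp [Real.pi_pos]

theorem ae_radialMeasure_iff {p : ℝ → Prop} :
    (∀ᵐ r ∂radialMeasure, p r) ↔ ∀ᵐ r ∂(volume.restrict (Ioo (0 : ℝ) 1)), p r := by
  rw [radialMeasure, ae_withDensity_iff (by fun_prop)]
  refine eventually_congr ?_
  filter_upwards [ae_restrict_mem measurableSet_Ioo] with r hr
  simp [hr.1]

theorem integral_radialMeasure (g : ℝ → ℂ) :
    ∫ r, g r ∂radialMeasure = ∫ r in Ioo (0 : ℝ) 1, ((2 * r : ℝ) : ℂ) * g r := by
  rw [radialMeasure, integral_withDensity_eq_integral_toReal_smul (by fun_prop)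
    (Eventually.of_forall fun _ => ENNReal.ofReal_lt_top)]
  refine setIntegral_congr_fun measurableSet_Ioo fun r hr => ?_
  have := hr.1
  rw [ENNReal.toReal_ofReal (by positivity), Complex.real_smul]

theorem integral_angleMeasure (g : ℝ → ℂ) :
    ∫ θ, g θ ∂angleMeasure = (1 / (2 * Real.pi) : ℂ) * ∫ θ in (0 : ℝ)..(2 * Real.pi), g θ := by
  have hpi := Real.pi_pos
  rw [angleMeasure, integral_smul_measure, intervalIntegral.integral_of_le (by positivity),
    ENNReal.toReal_ofReal (by positivity), Complex.real_smul]
  simp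

theorem measurable_circleMap_uncurry : Measurable fun p : ℝ × ℝ => circleMap 0 p.2 p.1 := by
  unfold circleMap
  fun_prop

theorem lintegral_two_mul_Ioo :
    ∫⁻ r in Ioo (0 : ℝ) 1, ENNReal.ofReal (2 * r) = 1 := by
  rw [← ofReal_integral_eq_lintegral_ofReal]
  · rw [← integral_Ioc_eq_integral_Ioo, ← intervalIntegral.integral_of_le zero_le_one,
      intervalIntegral.integral_const_mul, integral_id]
    norm_num
  · exact (Continuous.integrableOn_Icc (by fun_prop)).mono_set Ioo_subset_Icc_self
  · filter_upwards [ae_restrict_mem measurableSet_Ioo] with r hr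
    have := hr.1
    simp only [Pi.zero_apply]
    positivity

instance : IsProbabilityMeasure radialMeasure := by
  constructor
  rw [radialMeasure, withDensity_apply _ MeasurableSet.univ, Measure.restrict_univ]
  exact lintegral_two_mul_Ioo

/-- Polar coordinates present the normalized area measure as the product of normalized arc length
and the radial measure. -/
theorem measurePreserving_polar :
    MeasurePreserving (fun p : ℝ × ℝ => circleMap 0 p.2 p.1)
      (angleMeasure.prod radialMeasure) diskMeasure := by
  refine ⟨measurable_circleMap_uncurry, Measure.ext_of_lintegral _ fun f hf => ?_⟩
  have hpi := Real.pi_pos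
  rw [lintegral_map hf measurable_circleMap_uncurry,
    lintegral_prod (fun p : ℝ × ℝ => f (circleMap 0 p.2 p.1))
      (hf.comp measurable_circleMap_uncurry).aemeasurable]
  rw [diskMeasure, lintegral_smul_measure, ← lintegral_indicator measurableSet_ball,
    ← Complex.lintegral_comp_polarCoord_symm]
  set F : ℂ → ℝ≥0∞ := (Metric.ball (0 : ℂ) 1).indicator f with hF
  have hFm : Measurable F := hf.indicator measurableSet_ball
  have htar : polarCoord.target = Ioi (0 : ℝ) ×ˢ Ioo (-Real.pi) Real.pi := rfl
  have hsymm : ∀ p : ℝ × ℝ, Complex.polarCoord.symm p = circleMap 0 p.1 p.2 := fun p => by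
    simp [circleMap, Complex.polarCoord_symm_apply, Complex.exp_mul_I]
  simp only [hsymm]
  have hm2 : Measurable fun p : ℝ × ℝ => circleMap 0 p.1 p.2 := by
    unfold circleMap
    fun_prop
  have hmeas : Measurable fun p : ℝ × ℝ => ENNReal.ofReal p.1 • F (circleMap 0 p.1 p.2) :=
    Measurable.mul (by fun_prop) (hFm.comp hm2)
  rw [htar, Measure.volume_eq_prod, ← Measure.prod_restrict,
    lintegral_prod_symm _ hmeas.aemeasurable]
  set G : ℝ → ℝ≥0∞ := fun θ => ∫⁻ r in Ioo 0 1, ENNReal.ofReal r * f (circleMap 0 r θ) with hG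
  have hinner : ∀ θ, ∫⁻ r in Ioi (0 : ℝ), ENNReal.ofReal r • F (circleMap 0 r θ) = G θ := by
    intro θ
    have hs : Ioo (0 : ℝ) 1 = Iio 1 ∩ Ioi 0 := by ext; simp [and_comm]
    simp only [hG]
    rw [hs, ← Measure.restrict_restrict measurableSet_Iio,
      ← lintegral_indicator measurableSet_Iio]
    refine setLIntegral_congr_fun measurableSet_Ioi fun r hr => ?_
    have hr' : 0 < r := hr
    by_cases h : r < 1 <;> simp [hF, indicator, h, abs_of_pos hr']
  have hrad : ∀ θ, ∫⁻ r, f (circleMap 0 r θ) ∂radialMeasure = 2 * G θ := by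
    intro θ
    have hfc : Measurable fun r => f (circleMap 0 r θ) := by
      refine hf.comp ?_
      unfold circleMap
      fun_prop
    rw [radialMeasure, lintegral_withDensity_eq_lintegral_mul _ (by fun_prop) hfc]
    simp only [hG]
    rw [← lintegral_const_mul' _ _ (by simp)]
    refine lintegral_congr fun r => ?_
    simp [ENNReal.ofReal_mul, mul_assoc]
  have hper : ∀ θ, G (θ + 2 * Real.pi) = G θ := fun θ => by
    simp only [hG, periodic_circleMap 0 _ θ]
  have hswap : ∫⁻ θ in Ioo (-Real.pi) Real.pi, G θ = ∫⁻ θ in Ioc 0 (2 * Real.pi), G θ := by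
    have h2 : (0 : ℝ) < 2 * Real.pi := by positivity
    have h := (isAddFundamentalDomain_Ioc h2 (-Real.pi) volume).setLIntegral_eq
      (isAddFundamentalDomain_Ioc h2 0 volume) G ?_
    · rw [restrict_Ioo_eq_restrict_Ioc]
      rwa [show -Real.pi + 2 * Real.pi = Real.pi by ring, zero_add] at h
    · rintro ⟨g, hg⟩ x
      obtain ⟨k, rfl⟩ := AddSubgroup.mem_zmultiples_iff.1 hg
      have : Function.Periodic G (2 * Real.pi) := hper
      have h3 := this.zsmul k x
      simp only [AddSubgroup.mk_vadd, vadd_eq_add]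
      rw [add_comm]
      exact h3
  simp only [hinner, hrad]
  rw [hswap, angleMeasure, lintegral_smul_measure, lintegral_const_mul' _ _ (by simp),
    smul_eq_mul, smul_eq_mul, ← mul_assoc]
  congr 1
  rw [← ENNReal.ofReal_ofNat, ← ENNReal.ofReal_mul (by positivity)]
  congr 1
  field_simp

/-! ### Radial limits -/

/-- If `p` holds almost everywhere on the disc, then on almost every radius it holds almost
everywhere. -/
theorem ae_ae_circleMap {p : ℂ → Prop} (h : ∀ᵐ z ∂diskMeasure, p z) :
    ∀ᵐ θ ∂angleMeasure, ∀ᵐ r ∂(volume.restrict (Ioo (0 : ℝ) 1)), p (circleMap 0 r θ) := by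
  have h1 := measurePreserving_polar.quasiMeasurePreserving.ae h
  filter_upwards [Measure.ae_ae_of_ae_prod h1] with θ hθ
  exact ae_radialMeasure_iff.1 hθ

/-- Closed constraints valid almost everywhere on the disc pass to the radial limit. -/
theorem ae_mem_of_radial_limit {E : Type*} [TopologicalSpace E] {f : ℂ → E} {ft : ℝ → E}
    {s : Set E} (hs : IsClosed s) (hf : ∀ᵐ z ∂diskMeasure, f z ∈ s)
    (hlim : ∀ᵐ θ ∂angleMeasure, Tendsto (fun r : ℝ => f (circleMap 0 r θ)) (𝓝[<] 1) (𝓝 (ft θ))) :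
    ∀ᵐ θ ∂angleMeasure, ft θ ∈ s := by
  filter_upwards [ae_ae_circleMap hf, hlim] with θ h1 h2
  refine hs.mem_of_frequently_of_tendsto ?_ h2
  rw [frequently_iff]
  intro U hU
  obtain ⟨l, hl, hlU⟩ := (mem_nhdsLT_iff_exists_Ioo_subset' (zero_lt_one' ℝ)).1 hU
  have hl1 : max l 0 < 1 := max_lt hl one_pos
  have h3 : ∀ᵐ r ∂(volume.restrict (Ioo (max l 0) 1)), f (circleMap 0 r θ) ∈ s :=
    ae_restrict_of_ae_restrict_of_subset (Ioo_subset_Ioo_left (le_max_right _ _)) h1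
  have : (ae (volume.restrict (Ioo (max l 0) 1))).NeBot := by
    rw [ae_neBot, Ne, Measure.restrict_eq_zero, Real.volume_Ioo]
    simpa using hl1
  obtain ⟨r, hr, hr'⟩ := (h3.and (ae_restrict_mem measurableSet_Ioo)).exists
  exact ⟨r, hlU ⟨(le_max_left _ _).trans_lt hr'.1, hr'.2⟩, hr⟩

/-- The probability densities `(2n+2) r^(2n+1)` on `(0, 1)` concentrate at `1`. -/
theorem tendsto_integral_pow_mul {g : ℝ → ℂ} {L : ℂ} (hg : IntegrableOn g (Ioo 0 1))
    (hL : Tendsto g (𝓝[<] 1) (𝓝 L)) :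
    Tendsto (fun n : ℕ => ∫ r in Ioo (0 : ℝ) 1, ((2 * n + 2) * r ^ (2 * n + 1) : ℝ) • g r)
      atTop (𝓝 L) := by
  have hnb : Ioo (0 : ℝ) 1 ∈ 𝓝[Ioo 0 1] (1 : ℝ) := self_mem_nhdsWithin
  refine tendsto_setIntegral_peak_smul_of_integrableOn_of_tendsto (x₀ := (1 : ℝ))
    measurableSet_Ioo measurableSet_Ioo subset_rfl hnb (by simp) ?_ ?_ ?_ ?_ hg ?_
  · filter_upwards with n x hx
    have := hx.1
    positivity
  · intro u hu h1
    obtain ⟨δ, hδ, hball⟩ := Metric.isOpen_iff.1 hu 1 h1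
    set ρ : ℝ := max (1 - δ) 0 with hρ
    have hρ0 : 0 ≤ ρ := le_max_right _ _
    have hρ1 : ρ < 1 := max_lt (by linarith) one_pos
    have hlim : Tendsto (fun n : ℕ => (2 * n + 2 : ℝ) * ρ ^ (2 * n + 1)) atTop (𝓝 0) := by
      have h := ((tendsto_self_mul_const_pow_of_lt_one hρ0 hρ1).add
        (tendsto_pow_atTop_nhds_zero_of_lt_one hρ0 hρ1)).comp
        (tendsto_atTop_mono (fun n => by simp only [id]; omega : ∀ n : ℕ, id n ≤ 2 * n + 1)
          tendsto_id)
      rw [add_zero] at h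
      refine h.congr fun n => ?_
      simp only [Function.comp]
      push_cast
      ring
    rw [Metric.tendstoUniformlyOn_iff]
    intro ε hε
    filter_upwards [(tendsto_order.1 hlim).2 ε hε] with n hn x hx
    have hx0 : 0 < x := hx.1.1
    have hxρ : x ≤ ρ := by
      by_contra hcon
      push Not at hcon
      refine hx.2 (hball ?_)
      rw [Metric.mem_ball, Real.dist_eq, abs_lt]
      have := (le_max_left (1 - δ) 0).trans_lt hcon
      exact ⟨by linarith, by linarith [hx.1.2]⟩
    simp only [Pi.zero_apply, dist_zero_left]
    rw [Real.norm_of_nonneg (by positivity)]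
    refine lt_of_le_of_lt ?_ hn
    gcongr
  · refine tendsto_const_nhds.congr fun n => ?_
    rw [← integral_Ioc_eq_integral_Ioo, ← intervalIntegral.integral_of_le zero_le_one,
      intervalIntegral.integral_const_mul, integral_pow]
    push_cast
    have : (2 * n + 1 + 1 : ℝ) ≠ 0 := by positivity
    field_simp
    ring
  · filter_upwards with n
    exact Continuous.aestronglyMeasurable (by fun_prop)
  · refine hL.mono_left (nhdsWithin_mono _ Ioo_subset_Iio_self)

/-- A radial limit is almost everywhere measurable, as an almost everywhere limit of the weighted
radial means of `f`; by dominated convergence in the angle, its mean is the limit of the integrals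
of `f` against `(n+1) |z|^{2n}`. -/
theorem aestronglyMeasurable_radial_limit_and_tendsto {f : ℂ → ℂ} (hf : MemLp f ∞ diskMeasure)
    {ft : ℝ → ℂ} (hlim : ∀ᵐ θ ∂angleMeasure,
      Tendsto (fun r : ℝ => f (circleMap 0 r θ)) (𝓝[<] 1) (𝓝 (ft θ))) :
    AEStronglyMeasurable ft angleMeasure ∧
    Tendsto (fun n : ℕ => ∫ z, ((n + 1 : ℝ) * ‖z‖ ^ (2 * n) : ℝ) • f z ∂diskMeasure)
      atTop (𝓝 (∫ θ, ft θ ∂angleMeasure)) := by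
  obtain ⟨C, hC⟩ : ∃ C : ℝ, ∀ᵐ z ∂diskMeasure, ‖f z‖ ≤ C :=
    ⟨_, ae_le_lpNorm_exponent_top hf⟩
  set w : ℕ → ℂ → ℂ := fun n z => ((n + 1 : ℝ) * ‖z‖ ^ (2 * n) : ℝ) • f z with hw
  have hwm : ∀ n, AEStronglyMeasurable (w n) diskMeasure := fun n => by
    have hc : Continuous fun z : ℂ => ((n + 1 : ℝ) * ‖z‖ ^ (2 * n) : ℝ) := by fun_prop
    exact hc.aestronglyMeasurable.smul hf.1
  have hwi : ∀ n, Integrable (w n) diskMeasure := by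
    intro n
    refine Integrable.of_bound (hwm n) ((n + 1) * C) ?_
    filter_upwards [hC, ae_mem_disk] with z hz hz1
    rw [mem_ball_zero_iff] at hz1
    simp only [hw]
    rw [norm_smul, Real.norm_of_nonneg (by positivity)]
    gcongr
    exact mul_le_of_le_one_right (by positivity) (pow_le_one₀ (norm_nonneg _) hz1.le)
  set I : ℕ → ℝ → ℂ := fun n θ => ∫ r, w n (circleMap 0 r θ) ∂radialMeasure with hI
  have hprod : ∀ n, Integrable (fun p : ℝ × ℝ => w n (circleMap 0 p.2 p.1))
      (angleMeasure.prod radialMeasure) := fun n =>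
    measurePreserving_polar.integrable_comp_of_integrable (hwi n)
  have hint : ∀ n, ∫ z, w n z ∂diskMeasure = ∫ θ, I n θ ∂angleMeasure := by
    intro n
    rw [← measurePreserving_polar.map_eq, integral_map
      measurable_circleMap_uncurry.aemeasurable
      (by rw [measurePreserving_polar.map_eq]; exact hwm n), integral_prod _ (hprod n)]
  have hIm : ∀ n, AEStronglyMeasurable (I n) angleMeasure := fun n =>
    (hprod n).1.integral_prod_right'
  have hIr : ∀ n θ, I n θ =
      ∫ r in Ioo (0 : ℝ) 1, ((2 * n + 2) * r ^ (2 * n + 1) : ℝ) • f (circleMap 0 r θ) := by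
    intro n θ
    simp only [hI]
    rw [integral_radialMeasure]
    refine setIntegral_congr_fun measurableSet_Ioo fun r hr => ?_
    simp only [hw, Complex.real_smul, norm_circleMap_zero, abs_of_pos hr.1]
    push_cast
    ring
  have hfm := measurePreserving_polar.quasiMeasurePreserving
  have hIlim : ∀ᵐ θ ∂angleMeasure, Tendsto (fun n => I n θ) atTop (𝓝 (ft θ)) := by
    have hmeas : ∀ᵐ θ ∂angleMeasure, AEStronglyMeasurable (fun r => f (circleMap 0 r θ))
        radialMeasure :=
      (hf.1.comp_quasiMeasurePreserving hfm).prodMk_left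
    filter_upwards [hlim, ae_ae_circleMap hC, hmeas] with θ h1 h2 h3
    simp only [hIr]
    refine tendsto_integral_pow_mul ?_ h1
    refine Integrable.of_bound ?_ C h2
    refine h3.mono_ac fun s hs => ?_
    have := (ae_radialMeasure_iff (p := fun x => x ∉ s)).1 (measure_eq_zero_iff_ae_notMem.1 hs)
    exact measure_eq_zero_iff_ae_notMem.2 this
  have hbound : ∀ n, ∀ᵐ θ ∂angleMeasure, ‖I n θ‖ ≤ C := by
    intro n
    filter_upwards [ae_ae_circleMap hC] with θ h2
    rw [hIr]
    -- The weights `(2n+2) r^(2n+1)` have total mass one on `(0, 1)`.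
    have hi : IntegrableOn (fun r : ℝ => ((2 * n + 2) * r ^ (2 * n + 1) : ℝ) * C) (Ioo 0 1) :=
      (Continuous.integrableOn_Icc (by fun_prop)).mono_set Ioo_subset_Icc_self
    refine (norm_integral_le_of_norm_le hi ?_).trans (le_of_eq ?_)
    · filter_upwards [h2, ae_restrict_mem measurableSet_Ioo] with r hr hr0
      have := hr0.1
      rw [norm_smul, Real.norm_of_nonneg (by positivity)]
      gcongr
    · rw [← integral_Ioc_eq_integral_Ioo, ← intervalIntegral.integral_of_le zero_le_one,
        intervalIntegral.integral_mul_const, intervalIntegral.integral_const_mul, integral_pow]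
      push_cast
      have : (2 * n + 1 + 1 : ℝ) ≠ 0 := by positivity
      field_simp
      ring
  refine ⟨aestronglyMeasurable_of_tendsto_ae atTop hIm hIlim, ?_⟩
  refine Tendsto.congr (fun n => (hint n).symm) ?_
  exact tendsto_integral_of_dominated_convergence (fun _ => C) hIm (integrable_const C) hbound
    hIlim

/-! ### Functions and eigenvalues of symmetric operators -/

theorem spectrum_subset_range_eigenvalues {V : Type*} [NormedAddCommGroup V]
    [InnerProductSpace ℂ V] [FiniteDimensional ℂ V] {n : ℕ} {A : V →L[ℂ] V}
    (hA : A.toLinearMap.IsSymmetric) (hn : Module.finrank ℂ V = n) :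
    spectrum ℂ A ⊆ range fun i => (hA.eigenvalues hn i : ℂ) := by
  intro z hz
  have h1 : A = Module.End.toContinuousLinearMap V A.toLinearMap := by ext; rfl
  rw [h1, AlgEquiv.spectrum_eq, ← Module.End.hasEigenvalue_iff_mem_spectrum] at hz
  obtain ⟨i, hi⟩ := hA.exists_eigenvalues_eq hn hz
  exact ⟨i, hi⟩

theorem aeval_apply_of_apply_eq_smul {V : Type*} [NormedAddCommGroup V] [NormedSpace ℂ V]
    [FiniteDimensional ℂ V] {A : V →L[ℂ] V} {c : ℂ} {v : V} (hv : v ≠ 0) (h : A v = c • v)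
    (p : Polynomial ℂ) : Polynomial.aeval A p v = p.eval c • v := by
  have h1 : A = Module.End.toContinuousLinearMap V A.toLinearMap := by ext; rfl
  have h2 : Module.End.HasEigenvector A.toLinearMap c v :=
    ⟨Module.End.mem_eigenspace_iff.2 h, hv⟩
  rw [← Module.End.aeval_apply_of_hasEigenvector h2]
  have h3 := Polynomial.aeval_algHom_apply (Module.End.toContinuousLinearMap V).toAlgHom
    A.toLinearMap p
  rw [h1]
  exact congrArg (fun B : V →L[ℂ] V => B v) h3

/-- The spectrum is finite, so `ψ(A)` is a polynomial in `A` and acts on eigenvectors by `ψ`. -/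
theorem traceFun_eq_sum {V : Type*} [NormedAddCommGroup V] [InnerProductSpace ℂ V]
    [FiniteDimensional ℂ V] [CompleteSpace V] {n : ℕ} {A : V →L[ℂ] V}
    (hA : A.toLinearMap.IsSymmetric) (hn : Module.finrank ℂ V = n) (ψ : ℝ → ℂ) :
    traceFun ψ A = ∑ i, ψ (hA.eigenvalues hn i) := by
  have hsa : IsSelfAdjoint A := ContinuousLinearMap.isSelfAdjoint_iff_isSymmetric.2 hA
  have hnormal : IsStarNormal A := hsa.isStarNormal
  set s : Finset ℂ := Finset.univ.image fun i => (hA.eigenvalues hn i : ℂ) with hs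
  set p : Polynomial ℂ := Lagrange.interpolate s id fun z => ψ z.re with hp
  have heval : ∀ z ∈ s, p.eval z = ψ z.re := fun z hz =>
    Lagrange.eval_interpolate_at_node (fun z : ℂ => ψ z.re) (fun _ _ _ _ h => h) hz
  have hcfc : cfc (fun z : ℂ => ψ z.re) A = Polynomial.aeval A p := by
    rw [← cfc_polynomial p A]
    refine cfc_congr fun z hz => ?_
    obtain ⟨i, rfl⟩ := spectrum_subset_range_eigenvalues hA hn hz
    exact (heval _ (by simp [hs])).symm
  rw [traceFun, hcfc, LinearMap.trace_eq_sum_inner _ (hA.eigenvectorBasis hn)]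
  refine Finset.sum_congr rfl fun i _ => ?_
  have hv : A (hA.eigenvectorBasis hn i) =
      (hA.eigenvalues hn i : ℂ) • hA.eigenvectorBasis hn i := hA.apply_eigenvectorBasis hn i
  have hne : hA.eigenvectorBasis hn i ≠ 0 := (hA.eigenvectorBasis hn).orthonormal.ne_zero i
  rw [ContinuousLinearMap.coe_coe, aeval_apply_of_apply_eq_smul hne hv, inner_smul_right,
    heval _ (by simp [hs])]
  simp

theorem eigenvalueCount_eq_card {V : Type*} [NormedAddCommGroup V] [InnerProductSpace ℂ V]
    [FiniteDimensional ℂ V] {n : ℕ} {A : V →L[ℂ] V}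
    (hA : A.toLinearMap.IsSymmetric) (hn : Module.finrank ℂ V = n) (S : Set ℝ) :
    eigenvalueCount A S = Nat.card {i // hA.eigenvalues hn i ∈ S} := by
  classical
  rw [eigenvalueCount, hA.roots_charpoly_eq_eigenvalues hn, Multiset.countP_map,
    Nat.card_eq_fintype_card, Fintype.card_subtype, Finset.card_def, Finset.filter_val]
  congr 1
  refine Multiset.filter_congr fun i _ => ?_
  simp

/-! ### The monomial basis -/

theorem integral_exp_angleMeasure (k : ℤ) :
    ∫ θ : ℝ, Complex.exp (k * θ * Complex.I) ∂angleMeasure = if k = 0 then 1 else 0 := by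
  split_ifs with hk
  · simp [hk]
  · rw [integral_angleMeasure]
    have hc : (k * Complex.I : ℂ) ≠ 0 := by simp [hk]
    have h := integral_exp_mul_complex (a := 0) (b := 2 * Real.pi) hc
    have h2 : Complex.exp (k * Complex.I * ((2 * Real.pi : ℝ) : ℂ)) = 1 := by
      rw [← Complex.exp_int_mul_two_pi_mul_I k]
      congr 1
      push_cast
      ring
    rw [h2] at h
    have h3 : ∀ θ : ℝ, (k * θ * Complex.I : ℂ) = k * Complex.I * θ := fun θ => by ring
    simp only [h3, h]
    simp

theorem integral_pow_radialMeasure (n : ℕ) :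
    ∫ r : ℝ, (r : ℂ) ^ (2 * n) ∂radialMeasure = 1 / (n + 1) := by
  rw [integral_radialMeasure]
  have h : ∀ r : ℝ, ((2 * r : ℝ) : ℂ) * (r : ℂ) ^ (2 * n) = ((2 * r ^ (2 * n + 1) : ℝ) : ℂ) := by
    intro r
    push_cast
    ring
  simp only [h]
  rw [integral_complex_ofReal, ← integral_Ioc_eq_integral_Ioo,
    ← intervalIntegral.integral_of_le zero_le_one, intervalIntegral.integral_const_mul,
    integral_pow]
  push_cast
  have h1 : (2 * n + 1 + 1 : ℂ) ≠ 0 := by exact_mod_cast (by omega : 2 * n + 1 + 1 ≠ 0)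
  have h2 : (n + 1 : ℂ) ≠ 0 := by exact_mod_cast (by omega : n + 1 ≠ 0)
  simp
  field_simp
  ring

theorem integral_pow_mul_conj_pow (m n : ℕ) :
    ∫ z : ℂ, z ^ n * (starRingEnd ℂ z) ^ m ∂diskMeasure = if n = m then 1 / (n + 1 : ℂ) else 0 := by
  have hm : Continuous fun z : ℂ => z ^ n * (starRingEnd ℂ z) ^ m := by fun_prop
  rw [← measurePreserving_polar.map_eq, integral_map measurable_circleMap_uncurry.aemeasurable
    hm.aestronglyMeasurable]
  have h : ∀ p : ℝ × ℝ, circleMap 0 p.2 p.1 ^ n * (starRingEnd ℂ (circleMap 0 p.2 p.1)) ^ m =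
      Complex.exp (((n : ℤ) - (m : ℤ) : ℤ) * p.1 * Complex.I) * (p.2 : ℂ) ^ (n + m) := by
    rintro ⟨θ, r⟩
    simp only [circleMap_zero, map_mul, Complex.conj_ofReal, ← Complex.exp_conj, mul_pow,
      ← Complex.exp_nat_mul]
    rw [mul_mul_mul_comm, ← Complex.exp_add, ← pow_add, mul_comm]
    congr 2
    simp
    ring
  simp only [h]
  rw [integral_prod_mul (fun θ : ℝ => Complex.exp (((n : ℤ) - (m : ℤ) : ℤ) * θ * Complex.I))
    (fun r : ℝ => (r : ℂ) ^ (n + m)), integral_exp_angleMeasure]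
  by_cases hnm : n = m
  · subst hnm
    simp only [sub_self, if_true, ← two_mul, integral_pow_radialMeasure, one_mul]
  · rw [if_neg (by omega), if_neg hnm, zero_mul]

theorem coeFn_monomial (n : ℕ) :
    ((monomial n : Lp ℂ 2 diskMeasure) : ℂ → ℂ) =ᵐ[diskMeasure]
      fun z : ℂ => (Real.sqrt (n + 1) : ℂ) * z ^ n :=
  MemLp.coeFn_toLp (memLp_monomial n)

theorem orthonormal_monomial :
    Orthonormal ℂ fun n => (monomial n : Lp ℂ 2 diskMeasure) := by
  rw [orthonormal_iff_ite]
  intro m n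
  have h : inner ℂ (monomial m : Lp ℂ 2 diskMeasure) (monomial n : Lp ℂ 2 diskMeasure) =
      (Real.sqrt (m + 1) * Real.sqrt (n + 1) : ℂ) *
        ∫ z : ℂ, z ^ n * (starRingEnd ℂ z) ^ m ∂diskMeasure := by
    rw [L2.inner_def, ← integral_const_mul]
    refine integral_congr_ae ?_
    filter_upwards [coeFn_monomial m, coeFn_monomial n] with z hm hn
    rw [hm, hn]
    simp
    ring
  rw [h, integral_pow_mul_conj_pow]
  by_cases hmn : m = n
  · subst hmn
    have h2 : (m + 1 : ℂ) ≠ 0 := by exact_mod_cast (by omega : m + 1 ≠ 0)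
    rw [if_pos rfl, if_pos rfl, ← Complex.ofReal_mul, Real.mul_self_sqrt (by positivity)]
    push_cast
    field_simp
  · rw [if_neg hmn, if_neg (Ne.symm hmn), mul_zero]

theorem monomialSpan_eq_span_range (N : ℕ) : monomialSpan N =
    Submodule.span ℂ (range fun n : Fin (N + 1) => (monomial n : Lp ℂ 2 diskMeasure)) := by
  rw [monomialSpan]
  congr 1
  ext x
  simp only [mem_image, mem_Iic, mem_range]
  constructor
  · rintro ⟨n, hn, rfl⟩
    exact ⟨⟨n, by omega⟩, rfl⟩
  · rintro ⟨n, rfl⟩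
    exact ⟨n, by omega, rfl⟩

theorem finrank_monomialSpan (N : ℕ) : Module.finrank ℂ (monomialSpan N) = N + 1 := by
  rw [monomialSpan_eq_span_range]
  have h := orthonormal_monomial.linearIndependent.comp (fun n : Fin (N + 1) => (n : ℕ))
    Fin.val_injective
  exact (finrank_span_eq_card h).trans (Fintype.card_fin _)

/-- The orthonormal basis of `K_N` formed by the normalized monomials. -/
def monomialBasis (N : ℕ) : OrthonormalBasis (Fin (N + 1)) ℂ (monomialSpan N) :=
  have hv : Orthonormal ℂ fun n : Fin (N + 1) =>
      (⟨monomial n, Submodule.subset_span ⟨n, Nat.le_of_lt_succ n.2, rfl⟩⟩ : monomialSpan N) :=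
    (monomialSpan N).subtypeₗᵢ.orthonormal_comp_iff.1
      (orthonormal_monomial.comp (fun n : Fin (N + 1) => (n : ℕ)) Fin.val_injective)
  OrthonormalBasis.mk hv (hv.linearIndependent.span_eq_top_of_card_eq_finrank
    ((Fintype.card_fin _).trans (finrank_monomialSpan N).symm)).ge

theorem coe_monomialBasis (N : ℕ) (n : Fin (N + 1)) :
    (monomialBasis N n : Lp ℂ 2 diskMeasure) = monomial n := by
  simp [monomialBasis]

/-! ### Compressions of Toeplitz operators -/

/-- On `K_N` the Bergman projection is invisible: the compression of `T_f` has the sesquilinear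
form of multiplication by `f`. -/
theorem inner_compression {f : ℂ → ℂ} (hf : MemLp f ∞ diskMeasure) {N : ℕ}
    (v u : monomialSpan N) :
    inner ℂ v (compression hf.toLp N u) =
      ∫ z, f z * (starRingEnd ℂ ((v : Lp ℂ 2 diskMeasure) z) * (u : Lp ℂ 2 diskMeasure) z)
        ∂diskMeasure := by
  have h1 : inner ℂ v (compression hf.toLp N u) =
      inner ℂ (v : Lp ℂ 2 diskMeasure) (mulOp hf.toLp (u : Lp ℂ 2 diskMeasure)) := by
    simp only [compression, toeplitz, ContinuousLinearMap.comp_apply]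
    rw [Submodule.inner_orthogonalProjectionOnto_eq_of_mem_left]
    exact Submodule.inner_orthogonalProjectionOnto_eq_of_mem_left
      (⟨v, monomialSpan_le N v.2⟩ : bergmanSpace) _
  rw [h1, L2.inner_def]
  refine integral_congr_ae ?_
  have h2 : (mulOp hf.toLp (u : Lp ℂ 2 diskMeasure) : ℂ → ℂ) =ᵐ[diskMeasure]
      fun z => (hf.toLp : Lp ℂ ∞ diskMeasure) z * (u : Lp ℂ 2 diskMeasure) z :=
    ContinuousLinearMap.coeFn_holder (ContinuousLinearMap.mul ℂ ℂ) _ _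
  filter_upwards [h2, hf.coeFn_toLp] with z h3 h4
  rw [h3, h4, RCLike.inner_apply]
  ring

theorem integrable_mul_conj_mul {f : ℂ → ℂ} (hf : MemLp f ∞ diskMeasure)
    (v u : Lp ℂ 2 diskMeasure) :
    Integrable (fun z => f z * (starRingEnd ℂ (v z) * u z)) diskMeasure := by
  have h : Integrable (fun z => starRingEnd ℂ (v z) * u z) diskMeasure := by
    refine (L2.integrable_inner (𝕜 := ℂ) v u).congr (Eventually.of_forall fun z => ?_)
    simp [RCLike.inner_apply, mul_comm]
  exact h.essSup_smul hf.1 hf.eLpNorm_ne_top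

theorem isSymmetric_compression {σ : ℂ → ℝ}
    (hσ : MemLp (fun z => (σ z : ℂ)) ∞ diskMeasure) (N : ℕ) :
    (compression hσ.toLp N).toLinearMap.IsSymmetric := by
  intro v u
  rw [ContinuousLinearMap.coe_coe, ← inner_conj_symm, inner_compression, inner_compression,
    ← integral_conj]
  refine integral_congr_ae (Eventually.of_forall fun z => ?_)
  simp only [map_mul, Complex.conj_conj, Complex.conj_ofReal]
  ring

/-- The trace of a compression, computed in any orthonormal basis. -/
theorem trace_compression {f : ℂ → ℂ} (hf : MemLp f ∞ diskMeasure) {N : ℕ} {ι : Type*}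
    [Fintype ι] (b : OrthonormalBasis ι ℂ (monomialSpan N)) :
    LinearMap.trace ℂ _ (compression hf.toLp N).toLinearMap =
      ∑ i, ∫ z, f z * (starRingEnd ℂ ((b i : Lp ℂ 2 diskMeasure) z) *
        (b i : Lp ℂ 2 diskMeasure) z) ∂diskMeasure := by
  rw [LinearMap.trace_eq_sum_inner _ b]
  exact Finset.sum_congr rfl fun i _ => inner_compression hf _ _

theorem inner_monomialBasis_compression {f : ℂ → ℂ} (hf : MemLp f ∞ diskMeasure) {N : ℕ}
    (m n : Fin (N + 1)) :
    inner ℂ (monomialBasis N m) (compression hf.toLp N (monomialBasis N n)) =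
      (Real.sqrt (m + 1) * Real.sqrt (n + 1) : ℂ) *
        ∫ z, f z * (z ^ (n : ℕ) * (starRingEnd ℂ z) ^ (m : ℕ)) ∂diskMeasure := by
  rw [inner_compression, coe_monomialBasis, coe_monomialBasis, ← integral_const_mul]
  refine integral_congr_ae ?_
  filter_upwards [coeFn_monomial m, coeFn_monomial n] with z hm hn
  rw [hm, hn]
  simp
  ring

/-! ### Matrix coefficients and traces -/

/-- The matrix coefficient `⟨√(m+1) zᵐ, f √(n+1) zⁿ⟩` of the Toeplitz operator with symbol `f`. -/
def toeplitzCoeff (f : ℂ → ℂ) (m n : ℕ) : ℂ :=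
  (Real.sqrt (m + 1) * Real.sqrt (n + 1) : ℂ) *
    ∫ z, f z * (z ^ n * (starRingEnd ℂ z) ^ m) ∂diskMeasure

theorem tendsto_sqrt_mul_sqrt_div (i k : ℕ) :
    Tendsto (fun n : ℕ => Real.sqrt ((n + i : ℕ) + 1) * Real.sqrt ((n + k : ℕ) + 1) / (n + 1))
      atTop (𝓝 1) := by
  have h : ∀ i : ℕ, Tendsto (fun n : ℕ => (((n + i : ℕ) : ℝ) + 1) / (n + 1)) atTop (𝓝 1) := by
    intro i
    have h1 : Tendsto (fun n : ℕ => 1 + (i : ℝ) * (1 / ((n : ℝ) + 1))) atTop (𝓝 (1 + i * 0)) :=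
      (tendsto_one_div_add_atTop_nhds_zero_nat.const_mul _).const_add _
    rw [mul_zero, add_zero] at h1
    refine h1.congr fun n => ?_
    have : (n + 1 : ℝ) ≠ 0 := by positivity
    push_cast
    field_simp
    ring
  have h2 := (((h i).mul (h k)).sqrt)
  rw [mul_one, Real.sqrt_one] at h2
  refine h2.congr fun n => ?_
  rw [← Real.sqrt_mul (by positivity), div_mul_div_comm, Real.sqrt_div (by positivity),
    Real.sqrt_mul_self (by positivity)]

/-- Along each diagonal the coefficients of a Toeplitz operator on the Bergman space converge to
the corresponding Fourier coefficient of the radial limit. -/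
theorem tendsto_toeplitzCoeff {f : ℂ → ℂ} (hf : MemLp f ∞ diskMeasure) {ft : ℝ → ℂ}
    (hlim : ∀ᵐ θ ∂angleMeasure,
      Tendsto (fun r : ℝ => f (circleMap 0 r θ)) (𝓝[<] 1) (𝓝 (ft θ))) (i k : ℕ) :
    Tendsto (fun n : ℕ => toeplitzCoeff f (n + i) (n + k)) atTop
      (𝓝 (∫ θ, ft θ * Complex.exp (((k : ℤ) - (i : ℤ) : ℤ) * θ * Complex.I) ∂angleMeasure)) := by
  have hc : Continuous fun z : ℂ => z ^ k * (starRingEnd ℂ z) ^ i := by fun_prop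
  have hp : MemLp (fun z : ℂ => z ^ k * (starRingEnd ℂ z) ^ i) ∞ diskMeasure := by
    refine memLp_top_of_bound hc.aestronglyMeasurable 1 ?_
    filter_upwards [ae_mem_disk] with z hz
    rw [mem_ball_zero_iff] at hz
    rw [norm_mul, norm_pow, norm_pow, RCLike.norm_conj]
    exact mul_le_one₀ (pow_le_one₀ (norm_nonneg _) hz.le) (by positivity)
      (pow_le_one₀ (norm_nonneg _) hz.le)
  have h2 : MemLp (fun z : ℂ => f z * (z ^ k * (starRingEnd ℂ z) ^ i)) ∞ diskMeasure :=
    hp.mul hf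
  have hcirc : ∀ θ : ℝ, circleMap 0 1 θ ^ k * (starRingEnd ℂ (circleMap 0 1 θ)) ^ i =
      Complex.exp (((k : ℤ) - (i : ℤ) : ℤ) * θ * Complex.I) := by
    intro θ
    simp only [circleMap_zero, map_mul, Complex.conj_ofReal, ← Complex.exp_conj,
      ← Complex.exp_nat_mul, Complex.ofReal_one, one_mul]
    rw [← Complex.exp_add]
    congr 1
    simp
    ring
  have hl2 : ∀ᵐ θ ∂angleMeasure, Tendsto (fun r : ℝ => (fun z : ℂ =>
      f z * (z ^ k * (starRingEnd ℂ z) ^ i)) (circleMap 0 r θ)) (𝓝[<] 1)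
      (𝓝 (ft θ * Complex.exp (((k : ℤ) - (i : ℤ) : ℤ) * θ * Complex.I))) := by
    filter_upwards [hlim] with θ hθ
    rw [← hcirc]
    refine hθ.mul ?_
    have hcm : Continuous fun r : ℝ => circleMap 0 r θ := by
      unfold circleMap
      fun_prop
    exact ((hc.comp hcm).tendsto 1).mono_left nhdsWithin_le_nhds
  have h3 := (aestronglyMeasurable_radial_limit_and_tendsto h2 hl2).2
  have h4 : Tendsto (fun n : ℕ => ((Real.sqrt ((n + i : ℕ) + 1) * Real.sqrt ((n + k : ℕ) + 1) /
      (n + 1) : ℝ) : ℂ)) atTop (𝓝 ((1 : ℝ) : ℂ)) :=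
    (Complex.continuous_ofReal.tendsto 1).comp (tendsto_sqrt_mul_sqrt_div i k)
  have h5 := h4.mul h3
  rw [Complex.ofReal_one, one_mul] at h5
  refine h5.congr fun n => ?_
  have h6 : ∀ z : ℂ, ((n + 1 : ℝ) * ‖z‖ ^ (2 * n) : ℝ) • (f z * (z ^ k * (starRingEnd ℂ z) ^ i)) =
      (n + 1 : ℂ) * (f z * (z ^ (n + k) * (starRingEnd ℂ z) ^ (n + i))) := by
    intro z
    have : ((‖z‖ ^ (2 * n) : ℝ) : ℂ) = z ^ n * (starRingEnd ℂ z) ^ n := by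
      rw [← mul_pow, Complex.mul_conj, Complex.normSq_eq_norm_sq, pow_mul]
      push_cast
      ring
    rw [Complex.real_smul, Complex.ofReal_mul, this]
    push_cast
    ring
  simp only [h6]
  rw [integral_const_mul, toeplitzCoeff]
  have h7 : (n + 1 : ℂ) ≠ 0 := by exact_mod_cast (by omega : n + 1 ≠ 0)
  push_cast
  field_simp

theorem trace_compression_eq_sum_toeplitzCoeff {f : ℂ → ℂ} (hf : MemLp f ∞ diskMeasure) (N : ℕ) :
    LinearMap.trace ℂ _ (compression hf.toLp N).toLinearMap =
      ∑ n ∈ Finset.range (N + 1), toeplitzCoeff f n n := by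
  rw [LinearMap.trace_eq_sum_inner _ (monomialBasis N), ← Fin.sum_univ_eq_sum_range
    (fun n => toeplitzCoeff f n n)]
  exact Finset.sum_congr rfl fun n _ => inner_monomialBasis_compression hf n n

/-- The normalized traces of the compressions converge to the mean of the radial limit. -/
theorem tendsto_trace_compression {f : ℂ → ℂ} (hf : MemLp f ∞ diskMeasure) {ft : ℝ → ℂ}
    (hlim : ∀ᵐ θ ∂angleMeasure,
      Tendsto (fun r : ℝ => f (circleMap 0 r θ)) (𝓝[<] 1) (𝓝 (ft θ))) :
    Tendsto (fun N : ℕ => LinearMap.trace ℂ _ (compression hf.toLp N).toLinearMap / ((N : ℂ) + 1))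
      atTop (𝓝 (∫ θ, ft θ ∂angleMeasure)) := by
  have h := tendsto_toeplitzCoeff hf hlim 0 0
  simp only [add_zero, Nat.cast_zero, sub_self, Int.cast_zero, zero_mul, Complex.exp_zero,
    mul_one] at h
  have h2 := h.cesaro_smul.comp (tendsto_add_atTop_nat 1)
  refine h2.congr fun N => ?_
  simp only [Function.comp, trace_compression_eq_sum_toeplitzCoeff, Complex.real_smul]
  push_cast
  rw [div_eq_inv_mul]

/-! ### The Hilbert–Schmidt norm -/

/-- The sum of squares of the eigenvalues is the squared Hilbert–Schmidt norm. -/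
theorem sum_sq_eigenvalues {V : Type*} [NormedAddCommGroup V] [InnerProductSpace ℂ V]
    [FiniteDimensional ℂ V] {n : ℕ} {T : V →ₗ[ℂ] V} (hT : T.IsSymmetric)
    (hn : Module.finrank ℂ V = n) {ι : Type*} [Fintype ι] (b : OrthonormalBasis ι ℂ V) :
    ∑ i, hT.eigenvalues hn i ^ 2 = ∑ k, ∑ j, ‖(inner ℂ (b j) (T (b k)) : ℂ)‖ ^ 2 := by
  have key : ∀ v, inner ℂ v ((T ∘ₗ T) v) = ((‖T v‖ ^ 2 : ℝ) : ℂ) := by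
    intro v
    rw [LinearMap.comp_apply, ← hT, inner_self_eq_norm_sq_to_K]
    push_cast
    rfl
  have h1 := LinearMap.trace_eq_sum_inner (T ∘ₗ T) (hT.eigenvectorBasis hn)
  have h2 := LinearMap.trace_eq_sum_inner (T ∘ₗ T) b
  rw [h1] at h2
  simp only [key, ← Complex.ofReal_sum] at h2
  have h3 := Complex.ofReal_injective h2
  have h4 : ∀ i, ‖T (hT.eigenvectorBasis hn i)‖ ^ 2 = hT.eigenvalues hn i ^ 2 := by
    intro i
    rw [hT.apply_eigenvectorBasis, norm_smul, (hT.eigenvectorBasis hn).orthonormal.1 i, mul_one]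
    simp
  simp only [h4] at h3
  rw [h3]
  exact Finset.sum_congr rfl fun k _ => (b.sum_sq_norm_inner_right (T (b k))).symm

/-- The `2K+1` central diagonals, restricted to the columns `K, …, M + K`, lie in the square of
indices at most `M + 2K`. -/
theorem sum_band_le_sum_square {g : ℕ → ℕ → ℝ} (hg : ∀ m n, 0 ≤ g m n) (M K : ℕ) :
    ∑ n ∈ Finset.range (M + 1), ∑ i ∈ Finset.range (2 * K + 1), g (n + i) (n + K) ≤
      ∑ n ∈ Finset.range (M + 2 * K + 1), ∑ m ∈ Finset.range (M + 2 * K + 1), g m n := by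
  rw [← Finset.sum_product', ← Finset.sum_product']
  rw [← Finset.sum_image (f := fun p : ℕ × ℕ => g p.2 p.1)
    (g := fun p : ℕ × ℕ => (p.1 + K, p.1 + p.2))]
  · refine Finset.sum_le_sum_of_subset_of_nonneg ?_ fun _ _ _ => hg _ _
    intro p hp
    simp only [Finset.mem_image, Finset.mem_product, Finset.mem_range, Prod.exists] at hp ⊢
    obtain ⟨a, b, h, rfl⟩ := hp
    simp only
    omega
  · rintro ⟨a, b⟩ - ⟨c, d⟩ - h
    simp only [Prod.mk.injEq] at h ⊢
    omega

theorem fourierCoeffOn_eq_integral_angleMeasure (ft : ℝ → ℂ) (k : ℤ) :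
    fourierCoeffOn Real.two_pi_pos ft k =
      ∫ θ, ft θ * Complex.exp ((-k : ℤ) * θ * Complex.I) ∂angleMeasure := by
  have hpi := Real.pi_pos
  rw [fourierCoeffOn_eq_integral, integral_angleMeasure, Complex.real_smul, sub_zero]
  push_cast
  congr 1
  refine intervalIntegral.integral_congr fun θ _ => ?_
  simp only [fourier_coe_apply, smul_eq_mul]
  rw [mul_comm]
  congr 2
  have : (Real.pi : ℂ) ≠ 0 := by exact_mod_cast hpi.ne'
  push_cast
  field_simp

/-- Asymptotically, the normalized Hilbert–Schmidt norms of the compressions are at least the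
`L²` norm of the radial limit: any finite band of diagonals contributes, by Cesàro averaging, the
corresponding Fourier coefficients, and Parseval's identity sums these up. -/
theorem eventually_lt_sum_sq_toeplitzCoeff {f : ℂ → ℂ} (hf : MemLp f ∞ diskMeasure) {ft : ℝ → ℂ}
    (hlim : ∀ᵐ θ ∂angleMeasure,
      Tendsto (fun r : ℝ => f (circleMap 0 r θ)) (𝓝[<] 1) (𝓝 (ft θ)))
    (hft : MemLp ft ∞ angleMeasure) {S : ℝ} (hS : S < ∫ θ, ‖ft θ‖ ^ 2 ∂angleMeasure) :
    ∀ᶠ N : ℕ in atTop, S < (((N + 1 : ℕ) : ℝ))⁻¹ * ∑ n ∈ Finset.range (N + 1),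
      ∑ m ∈ Finset.range (N + 1), ‖toeplitzCoeff f m n‖ ^ 2 := by
  have hpi := Real.pi_pos
  set c : ℤ → ℂ := fourierCoeffOn Real.two_pi_pos ft with hc
  have hsum : HasSum (fun k => ‖c k‖ ^ 2) (∫ θ, ‖ft θ‖ ^ 2 ∂angleMeasure) := by
    have h2 : MemLp ft 2 (volume.restrict (Ioc 0 (2 * Real.pi))) := by
      have h1 : MemLp ft 2 angleMeasure := hft.mono_exponent le_top
      have h3 := h1.smul_measure (c := ENNReal.ofReal (2 * Real.pi)) ENNReal.ofReal_ne_top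
      rwa [angleMeasure, smul_smul, ← ENNReal.ofReal_mul (by positivity),
        mul_inv_cancel₀ (by positivity), ENNReal.ofReal_one, one_smul] at h3
    have h3 := hasSum_sq_fourierCoeffOn Real.two_pi_pos h2
    convert h3 using 1
    rw [angleMeasure, integral_smul_measure, intervalIntegral.integral_of_le (by positivity),
      ENNReal.toReal_ofReal (by positivity), sub_zero]
  obtain ⟨s, hs⟩ := ((tendsto_order.1 hsum).1 S hS).exists
  -- The band `|k| ≤ K` contains the finite set `s` of frequencies.
  set K : ℕ := s.sup Int.natAbs with hK
  set t : ℕ → ℝ := fun n =>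
    ∑ i ∈ Finset.range (2 * K + 1), ‖toeplitzCoeff f (n + i) (n + K)‖ ^ 2 with ht
  have htlim : Tendsto t atTop (𝓝 (∑ i ∈ Finset.range (2 * K + 1), ‖c ((i : ℤ) - K)‖ ^ 2)) := by
    refine tendsto_finsetSum _ fun i _ => ?_
    have h := tendsto_toeplitzCoeff hf hlim i K
    simp only [hc, fourierCoeffOn_eq_integral_angleMeasure, neg_sub]
    exact h.norm.pow 2
  have hband : S < ∑ i ∈ Finset.range (2 * K + 1), ‖c ((i : ℤ) - K)‖ ^ 2 := by
    refine hs.trans_le ?_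
    rw [← Finset.sum_image (f := fun k : ℤ => ‖c k‖ ^ 2) (g := fun i : ℕ => (i : ℤ) - K)]
    · refine Finset.sum_le_sum_of_subset_of_nonneg (fun k hk => ?_) fun _ _ _ => by positivity
      have hkK : k.natAbs ≤ K := Finset.le_sup (f := Int.natAbs) hk
      rw [Finset.mem_image]
      exact ⟨(k + K).toNat, by rw [Finset.mem_range]; omega, by omega⟩
    · intro a _ b _ h
      simpa using h
  have h1 := htlim.cesaro.comp (tendsto_add_atTop_nat 1)
  have h2 : Tendsto (fun M : ℕ => ((M + 1 : ℕ) : ℝ) / ((M + 2 * K + 1 : ℕ) : ℝ)) atTop (𝓝 1) := by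
    have h := (tendsto_natCast_div_add_atTop (𝕜 := ℝ) (2 * K : ℝ)).comp (tendsto_add_atTop_nat 1)
    refine h.congr fun M => ?_
    simp only [Function.comp]
    push_cast
    congr 1
    ring
  have h3 := h2.mul h1
  rw [one_mul] at h3
  have h4 := (tendsto_order.1 h3).1 S hband
  rw [← map_add_atTop_eq_nat (2 * K), eventually_map]
  filter_upwards [h4] with M hM
  refine hM.trans_le ?_
  have h5 : ((M + 1 : ℕ) : ℝ) ≠ 0 := by positivity
  simp only [Function.comp]
  rw [← mul_assoc, div_mul_eq_mul_div, mul_inv_cancel₀ h5, one_div]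
  refine mul_le_mul_of_nonneg_left ?_ (by positivity)
  exact sum_band_le_sum_square (g := fun m n => ‖toeplitzCoeff f m n‖ ^ 2)
    (fun _ _ => by positivity) M K

/-! ### The variance estimate -/

/-- Uniform continuity on a compact interval in quadratic form: nearby points are covered by `ε`,
distant ones by `C (x - y)²`. -/
theorem exists_dist_le_add_mul_sq {ψ : ℝ → ℂ} {a b : ℝ} (hψ : ContinuousOn ψ (Icc a b)) {ε : ℝ}
    (hε : 0 < ε) :
    ∃ C : ℝ, 0 ≤ C ∧ ∀ x ∈ Icc a b, ∀ y ∈ Icc a b, ‖ψ x - ψ y‖ ≤ ε + C * (x - y) ^ 2 := by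
  obtain ⟨B, hB⟩ := isCompact_Icc.exists_bound_of_continuousOn hψ
  obtain ⟨δ, hδ, h⟩ := Metric.uniformContinuousOn_iff.1
    (isCompact_Icc.uniformContinuousOn_of_continuous hψ) ε hε
  refine ⟨2 * |B| / δ ^ 2, by positivity, fun x hx y hy => ?_⟩
  by_cases hxy : |x - y| < δ
  · have h1 := h x hx y hy (by rwa [Real.dist_eq])
    rw [dist_eq_norm] at h1
    have : 0 ≤ 2 * |B| / δ ^ 2 * (x - y) ^ 2 := by positivity
    linarith
  · push Not at hxy
    have h1 : δ ^ 2 ≤ (x - y) ^ 2 := by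
      rw [← sq_abs (x - y)]
      gcongr
    have h2 : 2 * |B| ≤ 2 * |B| / δ ^ 2 * (x - y) ^ 2 := by
      rw [div_mul_eq_mul_div, le_div_iff₀ (by positivity)]
      gcongr
    have h3 : ‖ψ x - ψ y‖ ≤ |B| + |B| :=
      (norm_sub_le _ _).trans (add_le_add ((hB x hx).trans (le_abs_self B))
        ((hB y hy).trans (le_abs_self B)))
    linarith

/-- If `ψ` varies by at most `ε + C (x - y)²`, then its value at the mean of `s` with respect to a
probability density `w` differs from the mean of `ψ ∘ s` by at most `ε + C Var(s)`. -/
theorem norm_sub_integral_le_variance {Ω : Type*} [MeasurableSpace Ω] {μ : Measure Ω}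
    {w s : Ω → ℝ} {F : Ω → ℂ} (hw0 : ∀ x, 0 ≤ w x) (hw : Integrable w μ) (hw1 : ∫ x, w x ∂μ = 1)
    (hs : Integrable (fun x => s x * w x) μ) (hs2 : Integrable (fun x => s x ^ 2 * w x) μ)
    (hF : Integrable (fun x => F x * w x) μ) {l : ℝ} (hl : l = ∫ x, s x * w x ∂μ) {c : ℂ}
    {ε C : ℝ} (hbound : ∀ᵐ x ∂μ, ‖c - F x‖ ≤ ε + C * (l - s x) ^ 2) :
    ‖c - ∫ x, F x * w x ∂μ‖ ≤ ε + C * (∫ x, s x ^ 2 * w x ∂μ - l ^ 2) := by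
  have h1 : c - ∫ x, F x * w x ∂μ = ∫ x, (c - F x) * w x ∂μ := by
    have h2 : ∫ x, c * (w x : ℂ) ∂μ = c := by
      rw [integral_const_mul, integral_complex_ofReal, hw1, Complex.ofReal_one, mul_one]
    calc c - ∫ x, F x * w x ∂μ = ∫ x, c * (w x : ℂ) ∂μ - ∫ x, F x * w x ∂μ := by rw [h2]
      _ = ∫ x, (c * (w x : ℂ) - F x * w x) ∂μ :=
        (integral_sub (hw.ofReal.const_mul c) hF).symm
      _ = _ := integral_congr_ae (Eventually.of_forall fun x => by ring)
  have hi : Integrable (fun x => (ε + C * l ^ 2) * w x + C * (s x ^ 2 * w x)) μ :=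
    (hw.const_mul _).add (hs2.const_mul _)
  have hi2 : Integrable (fun x => 2 * C * l * (s x * w x)) μ := hs.const_mul _
  have h3 : ∫ x, ((ε + C * l ^ 2) * w x + C * (s x ^ 2 * w x) - 2 * C * l * (s x * w x)) ∂μ =
      ε + C * (∫ x, s x ^ 2 * w x ∂μ - l ^ 2) := by
    rw [integral_sub hi hi2, integral_add (hw.const_mul _) (hs2.const_mul _),
      integral_const_mul, integral_const_mul, integral_const_mul, hw1, ← hl]
    ring
  rw [h1, ← h3]
  refine norm_integral_le_of_norm_le (hi.sub hi2) ?_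
  filter_upwards [hbound] with x hx
  rw [norm_mul, Complex.norm_real, Real.norm_of_nonneg (hw0 x)]
  calc ‖c - F x‖ * w x ≤ (ε + C * (l - s x) ^ 2) * w x :=
        mul_le_mul_of_nonneg_right hx (hw0 x)
    _ = _ := by ring

theorem memLp_ofReal {g : ℂ → ℝ} (hg : MemLp g ∞ diskMeasure) :
    MemLp (fun z => (g z : ℂ)) ∞ diskMeasure :=
  hg.ofReal (K := ℂ)

theorem memLp_sq {g : ℂ → ℝ} (hg : MemLp g ∞ diskMeasure) :
    MemLp (fun z => g z ^ 2) ∞ diskMeasure := by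
  simp only [pow_two]
  exact hg.mul hg

theorem inner_eigenvectorBasis_apply {V : Type*} [NormedAddCommGroup V] [InnerProductSpace ℂ V]
    [FiniteDimensional ℂ V] {n : ℕ} {T : V →ₗ[ℂ] V} (hT : T.IsSymmetric)
    (hn : Module.finrank ℂ V = n) (i : Fin n) :
    inner ℂ (hT.eigenvectorBasis hn i) (T (hT.eigenvectorBasis hn i)) =
      (hT.eigenvalues hn i : ℂ) := by
  rw [hT.apply_eigenvectorBasis, inner_smul_right, inner_self_eq_norm_sq_to_K,
    (hT.eigenvectorBasis hn).orthonormal.1 i]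
  simp

theorem conj_mul_self_eq_ofReal (z : ℂ) : starRingEnd ℂ z * z = ((‖z‖ ^ 2 : ℝ) : ℂ) := by
  rw [mul_comm, Complex.mul_conj, Complex.normSq_eq_norm_sq]

theorem integrable_ofReal_mul_norm_sq {g : ℂ → ℝ} (hg : MemLp g ∞ diskMeasure)
    (u : Lp ℂ 2 diskMeasure) : Integrable (fun z => g z * ‖u z‖ ^ 2) diskMeasure := by
  have h := (integrable_mul_conj_mul (memLp_ofReal hg) u u).re
  refine h.congr (Eventually.of_forall fun z => ?_)
  simp only [conj_mul_self_eq_ofReal, ← Complex.ofReal_mul]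
  exact Complex.ofReal_re _

theorem integral_norm_sq_eq_one {N : ℕ} {u : monomialSpan N} (hu : ‖u‖ = 1) :
    ∫ z, ‖(u : Lp ℂ 2 diskMeasure) z‖ ^ 2 ∂diskMeasure = 1 := by
  have h1 : inner ℂ (u : Lp ℂ 2 diskMeasure) (u : Lp ℂ 2 diskMeasure) = (1 : ℂ) := by
    rw [inner_self_eq_norm_sq_to_K, Submodule.norm_coe, hu]
    simp
  rw [L2.inner_def] at h1
  have h2 : ∀ z, inner ℂ ((u : Lp ℂ 2 diskMeasure) z) ((u : Lp ℂ 2 diskMeasure) z) =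
      ((‖(u : Lp ℂ 2 diskMeasure) z‖ ^ 2 : ℝ) : ℂ) := fun z => by
    rw [inner_self_eq_norm_sq_to_K]
    push_cast
    rfl
  simp only [h2] at h1
  rw [integral_complex_ofReal] at h1
  exact_mod_cast h1

/-! ### Eigenvalues of the compressions -/

section Symbol

variable {σ : ℂ → ℝ} (hσ : MemLp σ ∞ diskMeasure) (N : ℕ)

/-- The eigenvalues of the compression of `T_σ` to `K_N`, in decreasing order. -/
def eigenvalue (j : Fin (N + 1)) : ℝ :=
  (isSymmetric_compression (memLp_ofReal hσ) N).eigenvalues (finrank_monomialSpan N) j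

/-- An orthonormal basis of `K_N` of eigenvectors belonging to `eigenvalue`. -/
def eigenbasis : OrthonormalBasis (Fin (N + 1)) ℂ (monomialSpan N) :=
  (isSymmetric_compression (memLp_ofReal hσ) N).eigenvectorBasis (finrank_monomialSpan N)

/-- The probability density `|u_j|²` on the disc defined by a normalized eigenvector. -/
def eigenDensity (j : Fin (N + 1)) (z : ℂ) : ℝ :=
  ‖(eigenbasis hσ N j : Lp ℂ 2 diskMeasure) z‖ ^ 2

theorem integral_eigenDensity (j : Fin (N + 1)) :
    ∫ z, eigenDensity hσ N j z ∂diskMeasure = 1 :=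
  integral_norm_sq_eq_one ((eigenbasis hσ N).orthonormal.1 j)

theorem integrable_mul_eigenDensity {g : ℂ → ℝ} (hg : MemLp g ∞ diskMeasure) (j : Fin (N + 1)) :
    Integrable (fun z => g z * eigenDensity hσ N j z) diskMeasure :=
  integrable_ofReal_mul_norm_sq hg _

theorem integrable_eigenDensity (j : Fin (N + 1)) :
    Integrable (eigenDensity hσ N j) diskMeasure := by
  simpa using integrable_mul_eigenDensity hσ N (memLp_const (1 : ℝ)) j

theorem integrable_complex_mul_eigenDensity {f : ℂ → ℂ} (hf : MemLp f ∞ diskMeasure)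
    (j : Fin (N + 1)) : Integrable (fun z => f z * (eigenDensity hσ N j z : ℂ)) diskMeasure := by
  have h := integrable_mul_conj_mul hf (eigenbasis hσ N j : Lp ℂ 2 diskMeasure)
    (eigenbasis hσ N j : Lp ℂ 2 diskMeasure)
  simpa only [conj_mul_self_eq_ofReal, eigenDensity] using h

/-- An eigenvalue is the mean of the symbol with respect to the density of its eigenvector. -/
theorem eigenvalue_eq_integral (j : Fin (N + 1)) :
    eigenvalue hσ N j = ∫ z, σ z * eigenDensity hσ N j z ∂diskMeasure := by
  have h1 := inner_compression (memLp_ofReal hσ) (eigenbasis hσ N j) (eigenbasis hσ N j)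
  have h2 : inner ℂ (eigenbasis hσ N j)
      (compression (memLp_ofReal hσ).toLp N (eigenbasis hσ N j)) = (eigenvalue hσ N j : ℂ) :=
    inner_eigenvectorBasis_apply (isSymmetric_compression (memLp_ofReal hσ) N)
      (finrank_monomialSpan N) j
  rw [h2] at h1
  simp only [conj_mul_self_eq_ofReal] at h1
  have h3 : ∀ z, ((σ z : ℝ) : ℂ) * ((‖(eigenbasis hσ N j : Lp ℂ 2 diskMeasure) z‖ ^ 2 : ℝ) : ℂ) =
      ((σ z * eigenDensity hσ N j z : ℝ) : ℂ) := fun z => by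
    rw [eigenDensity, Complex.ofReal_mul]
  have h4 : (eigenvalue hσ N j : ℂ) =
      ∫ z, ((σ z * eigenDensity hσ N j z : ℝ) : ℂ) ∂diskMeasure := by
    rw [← integral_congr_ae (Eventually.of_forall h3)]
    exact h1
  rw [integral_complex_ofReal] at h4
  exact_mod_cast h4

theorem eigenvalue_mem_Icc {a b : ℝ} (hab : ∀ᵐ z ∂diskMeasure, σ z ∈ Icc a b)
    (j : Fin (N + 1)) : eigenvalue hσ N j ∈ Icc a b := by
  have h1 : ∀ c : ℝ, ∫ z, c * eigenDensity hσ N j z ∂diskMeasure = c := fun c => by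
    rw [integral_const_mul, integral_eigenDensity, mul_one]
  have h2 := integrable_mul_eigenDensity hσ N hσ j
  have h3 : ∀ z, 0 ≤ eigenDensity hσ N j z := fun z => sq_nonneg _
  rw [eigenvalue_eq_integral]
  constructor
  · rw [← h1 a]
    refine integral_mono_ae ((integrable_eigenDensity hσ N j).const_mul a) h2 ?_
    filter_upwards [hab] with z hz
    exact mul_le_mul_of_nonneg_right hz.1 (h3 z)
  · rw [← h1 b]
    refine integral_mono_ae h2 ((integrable_eigenDensity hσ N j).const_mul b) ?_
    filter_upwards [hab] with z hz
    exact mul_le_mul_of_nonneg_right hz.2 (h3 z)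

theorem trace_compression_eq_sum_eigenDensity {f : ℂ → ℂ} (hf : MemLp f ∞ diskMeasure) :
    LinearMap.trace ℂ _ (compression hf.toLp N).toLinearMap =
      ∑ j, ∫ z, f z * (eigenDensity hσ N j z : ℂ) ∂diskMeasure := by
  rw [trace_compression hf (eigenbasis hσ N)]
  simp only [conj_mul_self_eq_ofReal]
  rfl

/-- The sum over all eigenvectors of the variance of the symbol with respect to the density
`|u_j|²`. -/
def totalVariance : ℝ :=
  ∑ j, (∫ z, σ z ^ 2 * eigenDensity hσ N j z ∂diskMeasure - eigenvalue hσ N j ^ 2)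

/-- The total variance is the difference of the trace of the compression of `T_{σ²}` and the squared
Hilbert–Schmidt norm of the compression of `T_σ`; both can be computed in the monomial basis. -/
theorem totalVariance_eq : totalVariance hσ N =
    (LinearMap.trace ℂ _ (compression (memLp_ofReal (memLp_sq hσ)).toLp N).toLinearMap).re -
      ∑ n ∈ Finset.range (N + 1), ∑ m ∈ Finset.range (N + 1),
        ‖toeplitzCoeff (fun z => (σ z : ℂ)) m n‖ ^ 2 := by
  rw [totalVariance, Finset.sum_sub_distrib, trace_compression_eq_sum_eigenDensity hσ]
  congr 1
  · rw [Complex.re_sum]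
    refine Finset.sum_congr rfl fun j _ => ?_
    have h : ∀ z, ((σ z ^ 2 : ℝ) : ℂ) * (eigenDensity hσ N j z : ℂ) =
        ((σ z ^ 2 * eigenDensity hσ N j z : ℝ) : ℂ) := fun z => by rw [Complex.ofReal_mul]
    rw [integral_congr_ae (Eventually.of_forall h), integral_complex_ofReal, Complex.ofReal_re]
  · have h := sum_sq_eigenvalues (isSymmetric_compression (memLp_ofReal hσ) N)
      (finrank_monomialSpan N) (monomialBasis N)
    refine h.trans ?_
    rw [← Fin.sum_univ_eq_sum_range (fun n => ∑ m ∈ Finset.range (N + 1),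
      ‖toeplitzCoeff (fun z => (σ z : ℂ)) m n‖ ^ 2)]
    refine Finset.sum_congr rfl fun n _ => ?_
    rw [← Fin.sum_univ_eq_sum_range (fun m => ‖toeplitzCoeff (fun z => (σ z : ℂ)) m n‖ ^ 2)]
    refine Finset.sum_congr rfl fun m _ => ?_
    rw [ContinuousLinearMap.coe_coe, inner_monomialBasis_compression]
    rfl

/-- The trace of `ψ(A_N)` and that of the compression of `T_{ψ∘σ}` differ by at most the total
variance, up to an error from the modulus of continuity of `ψ`. -/
theorem norm_sum_sub_trace_le {ψ : ℝ → ℂ} {a b : ℝ} (hab : ∀ᵐ z ∂diskMeasure, σ z ∈ Icc a b)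
    (hf : MemLp (fun z => ψ (σ z)) ∞ diskMeasure) {ε C : ℝ}
    (hψ : ∀ x ∈ Icc a b, ∀ y ∈ Icc a b, ‖ψ x - ψ y‖ ≤ ε + C * (x - y) ^ 2) :
    ‖∑ j, ψ (eigenvalue hσ N j) - LinearMap.trace ℂ _ (compression hf.toLp N).toLinearMap‖ ≤
      (N + 1) * ε + C * totalVariance hσ N := by
  rw [trace_compression_eq_sum_eigenDensity hσ, ← Finset.sum_sub_distrib]
  calc _ ≤ ∑ j, (ε + C * (∫ z, σ z ^ 2 * eigenDensity hσ N j z ∂diskMeasure -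
        eigenvalue hσ N j ^ 2)) := by
        refine norm_sum_le_of_le _ fun j _ => ?_
        refine norm_sub_integral_le_variance (fun z => sq_nonneg _)
          (integrable_eigenDensity hσ N j) (integral_eigenDensity hσ N j)
          (integrable_mul_eigenDensity hσ N hσ j)
          (integrable_mul_eigenDensity hσ N (memLp_sq hσ) j)
          (integrable_complex_mul_eigenDensity hσ N hf j) (eigenvalue_eq_integral hσ N j) ?_
        filter_upwards [hab] with z hz
        exact hψ _ (eigenvalue_mem_Icc hσ N hab j) _ hz
    _ = _ := by
        rw [Finset.sum_add_distrib, ← Finset.mul_sum, totalVariance]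
        simp

end Symbol

/-! ### Asymptotics of the eigenvalues -/

theorem HasRadialLimit.ae_angleMeasure {σ : ℂ → ℝ} {σt : ℝ → ℝ} (hlim : HasRadialLimit σ σt) :
    ∀ᵐ θ ∂angleMeasure, Tendsto (fun r : ℝ => σ (circleMap 0 r θ)) (𝓝[<] 1) (𝓝 (σt θ)) :=
  ae_angleMeasure_iff.2 hlim

theorem HasRadialLimit.ae_comp {σ : ℂ → ℝ} {σt : ℝ → ℝ} (hlim : HasRadialLimit σ σt)
    {g : ℝ → ℂ} (hg : Continuous g) :
    ∀ᵐ θ ∂angleMeasure,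
      Tendsto (fun r : ℝ => (fun z => g (σ z)) (circleMap 0 r θ)) (𝓝[<] 1) (𝓝 (g (σt θ))) := by
  filter_upwards [hlim.ae_angleMeasure] with θ hθ
  exact (hg.tendsto _).comp hθ

theorem HasRadialLimit.aemeasurable {σ : ℂ → ℝ} (hσ : MemLp σ ∞ diskMeasure) {σt : ℝ → ℝ}
    (hlim : HasRadialLimit σ σt) : AEMeasurable σt angleMeasure := by
  have h := (aestronglyMeasurable_radial_limit_and_tendsto (memLp_ofReal hσ)
    (hlim.ae_comp Complex.continuous_ofReal)).1
  exact Complex.measurable_re.comp_aemeasurable h.aemeasurable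

/-- The normalized total variance tends to zero: the second moments of the symbol converge to the
`L²` norm of the radial limit, which the Hilbert–Schmidt norms asymptotically exhaust. -/
theorem eventually_totalVariance_lt {σ : ℂ → ℝ} (hσ : MemLp σ ∞ diskMeasure) {σt : ℝ → ℝ}
    (hlim : HasRadialLimit σ σt) {a b : ℝ} (hab : ∀ᵐ z ∂diskMeasure, σ z ∈ Icc a b) {ε : ℝ}
    (hε : 0 < ε) : ∀ᶠ N : ℕ in atTop, totalVariance hσ N < (N + 1) * ε := by
  have hmem : ∀ᵐ θ ∂angleMeasure, σt θ ∈ Icc a b :=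
    ae_mem_of_radial_limit isClosed_Icc hab hlim.ae_angleMeasure
  have hft : MemLp (fun θ => (σt θ : ℂ)) ∞ angleMeasure := by
    refine memLp_top_of_bound (Complex.measurable_ofReal.comp_aemeasurable
      (hlim.aemeasurable hσ)).aestronglyMeasurable (max |a| |b|) ?_
    filter_upwards [hmem] with θ hθ
    rw [Complex.norm_real]
    exact abs_le_max_abs_abs hθ.1 hθ.2
  have h1 := eventually_lt_sum_sq_toeplitzCoeff (memLp_ofReal hσ)
    (hlim.ae_comp Complex.continuous_ofReal) hft
    (sub_lt_self (∫ θ, ‖(σt θ : ℂ)‖ ^ 2 ∂angleMeasure) (half_pos hε))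
  have h2 := tendsto_trace_compression (memLp_ofReal (memLp_sq hσ))
    (hlim.ae_comp (g := fun x => ((x ^ 2 : ℝ) : ℂ)) (by fun_prop))
  have h3 := (Complex.continuous_re.tendsto _).comp h2
  have h4 : (∫ θ, ((σt θ ^ 2 : ℝ) : ℂ) ∂angleMeasure).re = ∫ θ, ‖(σt θ : ℂ)‖ ^ 2 ∂angleMeasure := by
    rw [integral_complex_ofReal, Complex.ofReal_re]
    simp
  rw [h4] at h3
  filter_upwards [h1, (tendsto_order.1 h3).2 _ (lt_add_of_pos_right _ (half_pos hε))] with N h5 h6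
  rw [totalVariance_eq]
  have hN : (0 : ℝ) < N + 1 := by positivity
  have h7 : ((N : ℂ) + 1) = ((N + 1 : ℝ) : ℂ) := by push_cast; rfl
  simp only [Function.comp, h7, Complex.div_ofReal_re] at h6
  rw [div_lt_iff₀ hN] at h6
  push_cast at h5
  rw [lt_inv_mul_iff₀ hN] at h5
  refine (sub_lt_sub h6 h5).trans_eq ?_
  ring

/-- Szegő's limit theorem for sums of continuous functions over the eigenvalues. -/
theorem tendsto_sum_eigenvalue {σ : ℂ → ℝ} (hσ : MemLp σ ∞ diskMeasure) {σt : ℝ → ℝ}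
    (hlim : HasRadialLimit σ σt) {a b : ℝ} (hab : ∀ᵐ z ∂diskMeasure, σ z ∈ Icc a b) {ψ : ℝ → ℂ}
    (hψ : ContinuousOn ψ (Icc a b)) :
    Integrable (fun θ => ψ (σt θ)) angleMeasure ∧
    Tendsto (fun N : ℕ => (∑ j, ψ (eigenvalue hσ N j)) / ((N : ℂ) + 1)) atTop
      (𝓝 (∫ θ, ψ (σt θ) ∂angleMeasure)) := by
  obtain ⟨z₀, hz₀⟩ := hab.exists
  have hle : a ≤ b := hz₀.1.trans hz₀.2
  have hmem : ∀ᵐ θ ∂angleMeasure, σt θ ∈ Icc a b :=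
    ae_mem_of_radial_limit isClosed_Icc hab hlim.ae_angleMeasure
  -- A bounded continuous extension of `ψ` to the line.
  set φ : ℝ → ℂ := IccExtend hle ((Icc a b).domRestrict ψ) with hφ
  have hφc : Continuous φ := (continuousOn_iff_continuous_domRestrict.1 hψ).Icc_extend'
  have hφψ : ∀ x ∈ Icc a b, φ x = ψ x := fun x hx => by
    rw [hφ, IccExtend_of_mem hle _ hx, domRestrict_apply]
  obtain ⟨B, hB⟩ := isCompact_Icc.exists_bound_of_continuousOn hψ
  have hφm : MemLp (fun z => φ (σ z)) ∞ diskMeasure := by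
    refine memLp_top_of_bound (hφc.comp_aestronglyMeasurable hσ.1) B ?_
    filter_upwards [hab] with z hz
    rw [hφψ _ hz]
    exact hB _ hz
  have hlimφ := hlim.ae_comp hφc
  have hcongr : (fun θ => φ (σt θ)) =ᵐ[angleMeasure] fun θ => ψ (σt θ) := by
    filter_upwards [hmem] with θ hθ
    exact hφψ _ hθ
  have htr := tendsto_trace_compression hφm hlimφ
  rw [integral_congr_ae hcongr] at htr
  refine ⟨?_, ?_⟩
  · refine Integrable.of_bound
      ((aestronglyMeasurable_radial_limit_and_tendsto hφm hlimφ).1.congr hcongr) B ?_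
    filter_upwards [hmem] with θ hθ
    exact hB _ hθ
  · have hdiff : Tendsto (fun N : ℕ => (∑ j, ψ (eigenvalue hσ N j)) / ((N : ℂ) + 1) -
        LinearMap.trace ℂ _ (compression hφm.toLp N).toLinearMap / ((N : ℂ) + 1)) atTop (𝓝 0) := by
      rw [Metric.tendsto_nhds]
      intro ε hε
      -- Half of `ε` pays for the modulus of continuity, the other half for the variance.
      obtain ⟨C, hC0, hC⟩ := exists_dist_le_add_mul_sq
        (hψ.congr hφψ) (half_pos hε)
      have hε2 : 0 < ε / (2 * (C + 1)) := by positivity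
      filter_upwards [eventually_totalVariance_lt hσ hlim hab hε2] with N hN
      have hN1 : (0 : ℝ) < N + 1 := by positivity
      have h7 : ((N : ℂ) + 1) = ((N + 1 : ℝ) : ℂ) := by push_cast; rfl
      have h1 := norm_sum_sub_trace_le hσ N hab hφm hC
      have h2 : ∑ j, φ (eigenvalue hσ N j) = ∑ j, ψ (eigenvalue hσ N j) :=
        Finset.sum_congr rfl fun j _ => hφψ _ (eigenvalue_mem_Icc hσ N hab j)
      rw [h2] at h1
      rw [dist_zero_right, ← sub_div, norm_div, h7, Complex.norm_real,
        Real.norm_of_nonneg hN1.le, div_lt_iff₀ hN1]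
      refine h1.trans_lt ?_
      have h3 : C * totalVariance hσ N ≤ C * ((N + 1) * (ε / (2 * (C + 1)))) :=
        mul_le_mul_of_nonneg_left hN.le hC0
      have h4 : C * ((N + 1) * (ε / (2 * (C + 1)))) < (N + 1) * (ε / 2) := by
        have : C * ((N + 1) * (ε / (2 * (C + 1)))) = (N + 1) * (ε / 2) * (C / (C + 1)) := by
          field_simp
        rw [this]
        refine mul_lt_of_lt_one_right (by positivity) ?_
        rw [div_lt_one (by positivity)]
        linarith
      linarith
    have := hdiff.add htr
    simpa using this

/-! ### Weak convergence of the eigenvalue distributions -/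

/-- The normalized counting measure of the eigenvalues of the compression to `K_N`. -/
def eigenvalueDistribution {σ : ℂ → ℝ} (hσ : MemLp σ ∞ diskMeasure) (N : ℕ) :
    ProbabilityMeasure ℝ :=
  ⟨(PMF.uniformOfFintype (Fin (N + 1))).toMeasure.map (eigenvalue hσ N),
    Measure.isProbabilityMeasure_map (measurable_of_finite _).aemeasurable⟩

theorem integral_eigenvalueDistribution {σ : ℂ → ℝ} (hσ : MemLp σ ∞ diskMeasure) (N : ℕ)
    (g : BoundedContinuousFunction ℝ ℝ) :
    ∫ x, g x ∂(eigenvalueDistribution hσ N : Measure ℝ) =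
      (∑ j, g (eigenvalue hσ N j)) / ((N : ℝ) + 1) := by
  rw [eigenvalueDistribution, ProbabilityMeasure.coe_mk,
    integral_map (measurable_of_finite _).aemeasurable
      g.continuous.aestronglyMeasurable, PMF.integral_eq_sum]
  have h : ((N : ℝ≥0∞) + 1).toReal = N + 1 := by exact_mod_cast ENNReal.toReal_natCast (N + 1)
  simp [Finset.mul_sum, div_eq_inv_mul, h]

theorem eigenvalueDistribution_apply {σ : ℂ → ℝ} (hσ : MemLp σ ∞ diskMeasure) (N : ℕ)
    {S : Set ℝ} (hS : MeasurableSet S) :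
    ((eigenvalueDistribution hσ N : Measure ℝ) S).toReal =
      (eigenvalueCount (compression (memLp_ofReal hσ).toLp N) S : ℝ) / ((N : ℝ) + 1) := by
  classical
  rw [eigenvalueDistribution, ProbabilityMeasure.coe_mk,
    Measure.map_apply (measurable_of_finite _) hS,
    PMF.toMeasure_uniformOfFintype_apply _ (measurable_of_finite _ hS),
    eigenvalueCount_eq_card (isSymmetric_compression (memLp_ofReal hσ) N)
      (finrank_monomialSpan N)]
  simp only [ENNReal.toReal_div, ENNReal.toReal_natCast, Fintype.card_fin, Nat.cast_add,
    Nat.cast_one, Nat.card_eq_fintype_card]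
  rfl

/-- The distribution of the radial limit with respect to normalized arc length. -/
def radialLimitDistribution {σ : ℂ → ℝ} (hσ : MemLp σ ∞ diskMeasure) {σt : ℝ → ℝ}
    (hlim : HasRadialLimit σ σt) : ProbabilityMeasure ℝ :=
  ⟨angleMeasure.map σt, Measure.isProbabilityMeasure_map (hlim.aemeasurable hσ)⟩

/-- The eigenvalue distributions converge weakly to the distribution of the radial limit. -/
theorem tendsto_eigenvalueDistribution {σ : ℂ → ℝ} (hσ : MemLp σ ∞ diskMeasure) {σt : ℝ → ℝ}
    (hlim : HasRadialLimit σ σt) {a b : ℝ} (hab : ∀ᵐ z ∂diskMeasure, σ z ∈ Icc a b) :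
    Tendsto (eigenvalueDistribution hσ) atTop
      (𝓝 (radialLimitDistribution hσ hlim)) := by
  rw [ProbabilityMeasure.tendsto_iff_forall_integral_tendsto]
  intro g
  have h := (tendsto_sum_eigenvalue hσ hlim hab (ψ := fun x => (g x : ℂ))
    (Complex.continuous_ofReal.comp g.continuous).continuousOn).2
  rw [integral_complex_ofReal] at h
  have h2 := (Complex.continuous_re.tendsto _).comp h
  rw [radialLimitDistribution, ProbabilityMeasure.coe_mk, integral_map (hlim.aemeasurable hσ)
    g.continuous.aestronglyMeasurable]
  refine h2.congr fun N => ?_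
  have h7 : ((N : ℂ) + 1) = ((N + 1 : ℝ) : ℂ) := by push_cast; rfl
  rw [integral_eigenvalueDistribution, Function.comp, h7, ← Complex.ofReal_sum,
    ← Complex.ofReal_div, Complex.ofReal_re]

theorem ae_mem_Icc_essInf_essSup {g : ℂ → ℝ} (hg : MemLp g ∞ diskMeasure) :
    ∀ᵐ z ∂diskMeasure, g z ∈ Icc (essInf g diskMeasure) (essSup g diskMeasure) := by
  have hC := ae_le_lpNorm_exponent_top hg
  have h1 : IsBoundedUnder (· ≤ ·) (ae diskMeasure) g :=
    ⟨_, eventually_map.2 (hC.mono fun z hz => (le_abs_self _).trans hz)⟩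
  have h2 : IsBoundedUnder (· ≥ ·) (ae diskMeasure) g :=
    ⟨_, eventually_map.2 (hC.mono fun z hz => (abs_le.1 hz).1)⟩
  filter_upwards [ae_essInf_le h2, ae_le_essSup h1] with z hz1 hz2
  exact ⟨hz1, hz2⟩

theorem integrable_angleMeasure_iff {g : ℝ → ℂ} :
    Integrable g angleMeasure ↔ IntervalIntegrable g volume 0 (2 * Real.pi) := by
  have hpi := Real.pi_pos
  rw [angleMeasure, integrable_smul_measure (by simp [hpi]) ENNReal.ofReal_ne_top,
    intervalIntegrable_iff_integrableOn_Ioc_of_le (by positivity), IntegrableOn]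

theorem radialLimitDistribution_apply {σ : ℂ → ℝ} (hσ : MemLp σ ∞ diskMeasure) {σt : ℝ → ℝ}
    (hlim : HasRadialLimit σ σt) {S : Set ℝ} (hS : MeasurableSet S) :
    (radialLimitDistribution hσ hlim : Measure ℝ) S =
      ENNReal.ofReal (2 * Real.pi)⁻¹ *
        volume {θ : ℝ | θ ∈ Set.Ioc 0 (2 * Real.pi) ∧ σt θ ∈ S} := by
  rw [radialLimitDistribution, ProbabilityMeasure.coe_mk,
    Measure.map_apply_of_aemeasurable (hlim.aemeasurable hσ) hS, angleMeasure,
    Measure.smul_apply, Measure.restrict_apply' measurableSet_Ioc, smul_eq_mul, inter_comm]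
  rfl

end

end BergmanSzego

theorem mainTheorem4 (σ : ℂ → ℝ) (hσ : MemLp σ ∞ BergmanSzego.diskMeasure)
    (σt : ℝ → ℝ) (hlim : BergmanSzego.HasRadialLimit σ σt) :
    (∀ ψ : ℝ → ℂ,
      ContinuousOn ψ (Set.Icc (essInf σ BergmanSzego.diskMeasure)
        (essSup σ BergmanSzego.diskMeasure)) →
      IntervalIntegrable (fun θ => ψ (σt θ)) volume 0 (2 * Real.pi) ∧
      Tendsto
        (fun N : ℕ =>
          BergmanSzego.traceFun ψ (BergmanSzego.compression (hσ.ofReal (K := ℂ)).toLp N)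
            / ((N : ℂ) + 1))
        atTop
        (𝓝 ((1 / (2 * Real.pi) : ℂ) * ∫ θ in (0 : ℝ)..(2 * Real.pi), ψ (σt θ)))) ∧
    (∀ α β : ℝ,
      essInf σ BergmanSzego.diskMeasure < α → α < β →
      β < essSup σ BergmanSzego.diskMeasure → (0 < α ∨ β < 0) →
      volume {θ : ℝ | θ ∈ Set.Ioc 0 (2 * Real.pi) ∧ σt θ = α} = 0 →
      volume {θ : ℝ | θ ∈ Set.Ioc 0 (2 * Real.pi) ∧ σt θ = β} = 0 →
      Tendsto
        (fun N : ℕ =>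
          (BergmanSzego.eigenvalueCount
            (BergmanSzego.compression (hσ.ofReal (K := ℂ)).toLp N) (Set.Icc α β) : ℝ)
            / ((N : ℝ) + 1))
        atTop
        (𝓝 ((volume {θ : ℝ | θ ∈ Set.Ioc 0 (2 * Real.pi) ∧ α ≤ σt θ ∧ σt θ ≤ β}).toReal
          / (2 * Real.pi)))) := by
  have hpi := Real.pi_pos
  have hab := BergmanSzego.ae_mem_Icc_essInf_essSup hσ
  refine ⟨fun ψ hψ => ?_, fun α β _ _ _ _ hα0 hβ0 => ?_⟩
  · obtain ⟨h1, h2⟩ := BergmanSzego.tendsto_sum_eigenvalue hσ hlim hab hψ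
    refine ⟨BergmanSzego.integrable_angleMeasure_iff.1 h1, ?_⟩
    rw [← BergmanSzego.integral_angleMeasure]
    refine h2.congr fun N => ?_
    congr 1
    exact (BergmanSzego.traceFun_eq_sum (BergmanSzego.isSymmetric_compression
      (BergmanSzego.memLp_ofReal hσ) N) (BergmanSzego.finrank_monomialSpan N) ψ).symm
  · have hpt : ∀ c : ℝ, volume {θ : ℝ | θ ∈ Set.Ioc 0 (2 * Real.pi) ∧ σt θ = c} = 0 →
        (BergmanSzego.radialLimitDistribution hσ hlim : Measure ℝ) {c} = 0 := fun c hc => by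
      rw [BergmanSzego.radialLimitDistribution_apply hσ hlim (measurableSet_singleton c)]
      simp only [mem_singleton_iff, hc, mul_zero]
    have hfr : (BergmanSzego.radialLimitDistribution hσ hlim : Measure ℝ)
        (frontier (Icc α β)) = 0 := by
      refine measure_mono_null (t := {α} ∪ {β}) ?_ (measure_union_null (hpt α hα0) (hpt β hβ0))
      intro x hx
      rw [isClosed_Icc.frontier_eq, interior_Icc] at hx
      by_contra hcon
      simp only [mem_union, mem_singleton_iff, not_or] at hcon
      exact hx.2 ⟨lt_of_le_of_ne hx.1.1 (Ne.symm hcon.1), lt_of_le_of_ne hx.1.2 hcon.2⟩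
    have h1 := ProbabilityMeasure.tendsto_measure_of_null_frontier_of_tendsto'
      (BergmanSzego.tendsto_eigenvalueDistribution hσ hlim hab) hfr
    have h2 := (ENNReal.tendsto_toReal (measure_ne_top _ _)).comp h1
    rw [BergmanSzego.radialLimitDistribution_apply hσ hlim measurableSet_Icc,
      ENNReal.toReal_mul, ENNReal.toReal_ofReal (by positivity), ← div_eq_inv_mul] at h2
    refine h2.congr fun N => ?_
    exact BergmanSzego.eigenvalueDistribution_apply hσ N measurableSet_Icc
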